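/- Let $d\ge 1$, $\delta,\epsilon,\eta>0$, and let $\Omega\subset\mathbb R^d$ be open and bounded. Put $\Omega_{\mathcal I_\delta}=\{x\notin\Omega:\ \mathrm{dist}(x,\partial\Omega)<\delta\}$ and $\Omega_\delta=\Omega\cup\Omega_{\mathcal I_\delta}$. Let $\gamma\ge 0$ be a non-increasing function on $(0,1]$ (possibly unbounded near $0$) with $\int_{B_1(0)}\gamma(|s|)|s|^2\,ds=d$, and put $$\gamma_\delta(r)=\delta^{-d-2}\gamma(r/\delta),\qquad \gamma^{\rm conv}_\delta(r)=\tfrac{r}{\eta}\gamma_\delta(r)\quad(0<r\le\delta),$$ both being $0$ for $r>\delta$. Let $\mathbf b\in L^\infty(\mathbb R^d;\mathbb R^d)$, and for each $x$ let $\mathcal H_\delta(x)\subset B_\delta(x)$ be an influence region with $|\mathcal H_\delta(x)|=\eta|B_\delta(x)|$ whenever $\mathbf b(x)\ne 0$. Let $\mathcal S_\delta(\Omega)$ be the space of (classes of) functions $u\in L^2(\Omega_\delta)$ with $u=0$ a.e. on $\Omega_{\mathcal I_\delta}$ and $\int_{\Omega_\delta}\int_{\Omega_\delta}\gamma_\delta(|y-x|)(u(y)-u(x))^2\,dy\,dx<\infty$,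 and put $$a(u,v)=\int_{\Omega_\delta}\int_{\Omega_\delta}\gamma_\delta(|y-x|)(u(y)-u(x))(v(y)-v(x))\,dy\,dx,\qquad \|u\|_{\mathcal S_\delta}=a(u,u)^{1/2}.$$ Let $\mathcal S_\delta^*$ be the space of linear functionals on $\mathcal S_\delta(\Omega)$ that are bounded for $\|\cdot\|_{\mathcal S_\delta}$, and let $(\cdot,\cdot)$ be the $L^2(\Omega)$ inner product, and also the pairing of $\mathcal S_\delta^*$ with $\mathcal S_\delta(\Omega)$. Define $$\mathcal G_\delta u(x)=\int_{\mathcal H_\delta(x)}\tfrac{y-x}{|y-x|}\gamma^{\rm conv}_\delta(|y-x|)(u(y)-u(x))\,dy,\qquad b(u,v)=\epsilon\,a(u,v)+(\mathbf b\cdot\mathcal G_\delta u,v),$$ $$\mathcal L_\delta u(x)=2\int_{B_\delta(x)}\gamma_\delta(|y-x|)(u(y)-u(x))\,dy,$$ $$\mathcal D_\delta(\mathbf w)(x)=\int_{\mathbb R^d}\big(\mathbf w(x)1_{\mathcal H_\delta(x)}(y)+\mathbf w(y)1_{\mathcal H_\delta(y)}(x)\big)\cdot\tfrac{y-x}{|y-x|}\gamma^{\rm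 conv}_\delta(|y-x|)\,dy.$$ The integrals $\mathcal L_\delta u$ and $\mathcal D_\delta(\mathbf w)$ are understood as principal values in $\mathcal S_\delta^*$: with the integrals restricted to $|y-x|>r$ and called $F_r$, the functional is $\varphi\mapsto\lim_{r\downarrow0}(F_r,\varphi)$. Assume one of the following. (1) $\mathbf b$ is constant and $\mathcal H_\delta(x)=B_\delta(x)$ for all $x$. (2) $\mathcal H_\delta(x)=\{y\in B_\delta(x):\ -\mathbf b(x)\cdot(y-x)>0\}$ for all $x$, and $-\mathcal D_\delta(\mathbf b)\ge0$ on $\Omega$, i.e. $\mathcal D_\delta(\mathbf b)$ exists in $\mathcal S_\delta^*$ and $(-\mathcal D_\delta(\mathbf b),\varphi)\ge 0$ for every $\varphi\in\mathcal S_\delta(\Omega)$ with $\varphi\ge0$ a.e. Then $\|v\|_{\rm opt}=\sup_{u\in\mathcal S_\delta(\Omega),\,u\ne0}|b(u,v)|/\|u\|_{\mathcal S_\delta}$ (read as $0$ if $\mathcal S_\delta(\Omega)=\{0\}$) is finite for every $v\in\mathcal S_\delta(\Omega)$ and is a norm on $V=\mathcal S_\delta(\Omega)$. Moreover $-\mathcal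 L_\delta$ is a well-defined linear bijection of $\mathcal S_\delta(\Omega)$ onto $\mathcal S_\delta^*$, $\mathcal D_\delta(\mathbf b v)\in\mathcal S_\delta^*$ is well defined for every $v\in\mathcal S_\delta(\Omega)$, and $$\|v\|_{\rm opt}^2=\epsilon^2\|v\|_{\mathcal S_\delta}^2+2\epsilon(\mathbf b\cdot\mathcal G_\delta v,v)+\big(\mathcal D_\delta(\mathbf b v),(-\mathcal L_\delta)^{-1}\mathcal D_\delta(\mathbf b v)\big)\qquad\text{for all }v\in\mathcal S_\delta(\Omega).$$ In case (1), $(\mathbf b\cdot\mathcal G_\delta v,v)=0$ for all $v$, so that $$\|v\|_{\rm opt}^2=\epsilon^2\|v\|_{\mathcal S_\delta}^2+\big(\mathcal D_\delta(\mathbf b v),(-\mathcal L_\delta)^{-1}\mathcal D_\delta(\mathbf b v)\big).$$ -/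

import Mathlib

open MeasureTheory Filter Topology Set

noncomputable section

namespace NonlocalConvection

/-- `ℝᵈ` with its Euclidean structure. -/
abbrev Euc (d : ℕ) : Type := EuclideanSpace ℝ (Fin d)

/-- A radial diffusion kernel: non-negative, non-increasing in the radius, with second moment `d`
on the unit ball. Only its values on `(0,1]` matter, and it may blow up at the origin. -/
structure DiffusionKernel (d : ℕ) where
  toFun : ℝ → ℝ
  nonneg : ∀ r ∈ Ioc (0 : ℝ) 1, 0 ≤ toFun r
  antitoneOn : AntitoneOn toFun (Ioc (0 : ℝ) 1)
  integrable_moment :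
    IntegrableOn (fun s : Euc d => toFun ‖s‖ * ‖s‖ ^ 2) (Metric.ball 0 1) volume
  second_moment : ∫ s in Metric.ball (0 : Euc d) 1, toFun ‖s‖ * ‖s‖ ^ 2 = d

variable {d : ℕ}

/-- The rescaled diffusion kernel `δ^{-(d+2)} γ(r/δ)`, supported in `r ≤ δ`. -/
def DiffusionKernel.diff (γ : DiffusionKernel d) (δ r : ℝ) : ℝ :=
  if r ∈ Ioc 0 δ then (1 / δ ^ (d + 2)) * γ.toFun (r / δ) else 0

/-- The rescaled convection kernel `δ^{-(d+1)} γconv(r/δ)`, supported in `r ≤ δ`, where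
`γconv(r) = (r/η) γ(r)`. -/
def DiffusionKernel.conv (γ : DiffusionKernel d) (η δ r : ℝ) : ℝ :=
  if r ∈ Ioc 0 δ then (1 / δ ^ (d + 1)) * ((r / δ) / η * γ.toFun (r / δ)) else 0

theorem DiffusionKernel.measurable_diff (γ : DiffusionKernel d) (δ : ℝ) :
    Measurable (γ.diff δ) := by
  refine measurable_of_restrict_of_restrict_compl (s := Ioc 0 δ) measurableSet_Ioc ?_ ?_
  · have h : (Ioc 0 δ).domRestrict (γ.diff δ)
        = fun r : Ioc 0 δ => (1 / δ ^ (d + 2)) * γ.toFun (r / δ) := by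
      funext r
      simp only [Set.domRestrict_apply, DiffusionKernel.diff, if_pos r.2]
    rw [h]
    refine Measurable.const_mul (Antitone.measurable ?_) _
    intro r s hrs
    have hδ : 0 < δ := lt_of_lt_of_le r.2.1 r.2.2
    have mem : ∀ t : Ioc 0 δ, (t : ℝ) / δ ∈ Ioc (0 : ℝ) 1 := fun t =>
      ⟨div_pos t.2.1 hδ, (div_le_one hδ).2 t.2.2⟩
    exact γ.antitoneOn (mem r) (mem s) (div_le_div_of_nonneg_right hrs hδ.le)
  · have h : (Ioc 0 δ)ᶜ.domRestrict (γ.diff δ) = fun _ => 0 := by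
      funext r
      simp only [Set.domRestrict_apply, DiffusionKernel.diff, if_neg r.2]
    rw [h]
    exact measurable_const

theorem DiffusionKernel.diff_nonneg (γ : DiffusionKernel d) (δ r : ℝ) : 0 ≤ γ.diff δ r := by
  unfold DiffusionKernel.diff
  split_ifs with h
  · have hδ : 0 < δ := lt_of_lt_of_le h.1 h.2
    exact mul_nonneg (by positivity)
      (γ.nonneg _ ⟨div_pos h.1 hδ, (div_le_one hδ).2 h.2⟩)
  · exact le_rfl

/-- The interaction domain `{x ∉ Ω : dist(x, ∂Ω) < δ}`. -/
def interactionDomain (δ : ℝ) (Ω : Set (Euc d)) : Set (Euc d) :=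
  {x | x ∉ Ω ∧ Metric.infDist x (frontier Ω) < δ}

/-- `Ω_δ = Ω ∪ interactionDomain`. -/
def extendedDomain (δ : ℝ) (Ω : Set (Euc d)) : Set (Euc d) :=
  Ω ∪ interactionDomain δ Ω

/-- The real space `L²(Ω_δ)`. -/
abbrev L2Ext (δ : ℝ) (Ω : Set (Euc d)) : Type :=
  Lp ℝ 2 ((volume : Measure (Euc d)).restrict (extendedDomain δ Ω))

/-- `∫_{Ω_δ} ∫_{Ω_δ} γ_δ(|y - x|) (u(y) - u(x))² dy dx`, as an extended non-negative number. -/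
def energyLIntegral (γ : DiffusionKernel d) (δ : ℝ) (Ω : Set (Euc d)) (u : Euc d → ℝ) :
    ENNReal :=
  ∫⁻ x in extendedDomain δ Ω, ∫⁻ y in extendedDomain δ Ω,
    ENNReal.ofReal (γ.diff δ ‖y - x‖ * (u y - u x) ^ 2)

theorem energyLIntegral_congr (γ : DiffusionKernel d) (δ : ℝ) (Ω : Set (Euc d))
    {u v : Euc d → ℝ} (h : u =ᵐ[volume.restrict (extendedDomain δ Ω)] v) :
    energyLIntegral γ δ Ω u = energyLIntegral γ δ Ω v := by
  refine lintegral_congr_ae ?_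
  filter_upwards [h] with x hx
  refine lintegral_congr_ae ?_
  filter_upwards [h] with y hy
  rw [hx, hy]

theorem energyLIntegral_smul (γ : DiffusionKernel d) (δ : ℝ) (Ω : Set (Euc d)) (c : ℝ)
    (u : Euc d → ℝ) :
    energyLIntegral γ δ Ω (fun x => c * u x)
      = ENNReal.ofReal (c ^ 2) * energyLIntegral γ δ Ω u := by
  unfold energyLIntegral
  rw [← lintegral_const_mul' _ _ ENNReal.ofReal_ne_top]
  refine lintegral_congr fun x => ?_
  rw [← lintegral_const_mul' _ _ ENNReal.ofReal_ne_top]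
  refine lintegral_congr fun y => ?_
  rw [← ENNReal.ofReal_mul (sq_nonneg c)]
  congr 1
  ring

theorem lintegral_two_mul_add {α : Type*} [MeasurableSpace α] {μ : Measure α}
    {f g : α → ENNReal} (hf : Measurable f) :
    ∫⁻ x, 2 * (f x + g x) ∂μ = 2 * (∫⁻ x, f x ∂μ + ∫⁻ x, g x ∂μ) := by
  rw [lintegral_const_mul' 2 _ (by norm_num), lintegral_add_left hf]

theorem energy_pointwise_le {k a b : ℝ} (hk : 0 ≤ k) :
    ENNReal.ofReal (k * (a + b) ^ 2)
      ≤ 2 * (ENNReal.ofReal (k * a ^ 2) + ENNReal.ofReal (k * b ^ 2)) := by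
  have h2 : (2 : ENNReal) = ENNReal.ofReal 2 := by simp
  rw [← ENNReal.ofReal_add (mul_nonneg hk (sq_nonneg a)) (mul_nonneg hk (sq_nonneg b)), h2,
    ← ENNReal.ofReal_mul (by norm_num)]
  refine ENNReal.ofReal_le_ofReal ?_
  linarith [mul_nonneg hk (sq_nonneg (a - b)),
    show k * (a + b) ^ 2 + k * (a - b) ^ 2 = 2 * (k * a ^ 2 + k * b ^ 2) by ring]

theorem lintegral_lintegral_two_mul_add_le {α : Type*} [MeasurableSpace α] {μ : Measure α}
    [SFinite μ] {f g h : α → α → ENNReal} (hf : Measurable (Function.uncurry f))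
    (hle : ∀ x y, h x y ≤ 2 * (f x y + g x y)) :
    ∫⁻ x, ∫⁻ y, h x y ∂μ ∂μ ≤ 2 * (∫⁻ x, ∫⁻ y, f x y ∂μ ∂μ + ∫⁻ x, ∫⁻ y, g x y ∂μ ∂μ) := by
  rw [← lintegral_two_mul_add hf.lintegral_prod_right]
  refine lintegral_mono fun x => ?_
  rw [← lintegral_two_mul_add (hf.of_uncurry_left (x := x))]
  exact lintegral_mono (hle x)

theorem energyLIntegral_add_le (γ : DiffusionKernel d) (δ : ℝ) (Ω : Set (Euc d))
    {u v : Euc d → ℝ} (hu : Measurable u) :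
    energyLIntegral γ δ Ω (fun x => u x + v x)
      ≤ 2 * (energyLIntegral γ δ Ω u + energyLIntegral γ δ Ω v) := by
  unfold energyLIntegral
  refine lintegral_lintegral_two_mul_add_le ?_ fun x y => ?_
  · refine ENNReal.measurable_ofReal.comp (Measurable.mul ?_ ?_)
    · exact (γ.measurable_diff δ).comp (measurable_snd.sub measurable_fst).norm
    · exact ((hu.comp measurable_snd).sub (hu.comp measurable_fst)).pow_const 2
  · have h := energy_pointwise_le (a := u y - u x) (b := v y - v x) (γ.diff_nonneg δ ‖y - x‖)
    rwa [show u y - u x + (v y - v x) = u y + v y - (u x + v x) by ring] at h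

/-- The energy space: classes `u ∈ L²(Ω_δ)` of finite energy that vanish on the interaction
domain. -/
def energySpace (γ : DiffusionKernel d) (δ : ℝ) (Ω : Set (Euc d)) :
    Submodule ℝ (L2Ext δ Ω) where
  carrier := {u | energyLIntegral γ δ Ω u < ⊤ ∧
    ∀ᵐ x ∂(volume.restrict (extendedDomain δ Ω)), x ∈ interactionDomain δ Ω → u x = 0}
  zero_mem' := by
    refine ⟨?_, ?_⟩
    · rw [energyLIntegral_congr γ δ Ω (Lp.coeFn_zero ℝ 2 _)]
      simp [energyLIntegral]
    · filter_upwards [Lp.coeFn_zero ℝ 2 (volume.restrict (extendedDomain δ Ω))] with x hx _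
      simpa using hx
  add_mem' := by
    intro u v hu hv
    refine ⟨?_, ?_⟩
    · rw [energyLIntegral_congr γ δ Ω (Lp.coeFn_add u v)]
      refine (energyLIntegral_add_le γ δ Ω (Lp.stronglyMeasurable u).measurable).trans_lt ?_
      exact ENNReal.mul_lt_top (by norm_num) (ENNReal.add_lt_top.2 ⟨hu.1, hv.1⟩)
    · filter_upwards [Lp.coeFn_add u v, hu.2, hv.2] with x hx h1 h2 hxI
      rw [hx, Pi.add_apply, h1 hxI, h2 hxI, add_zero]
  smul_mem' := by
    intro c u hu
    refine ⟨?_, ?_⟩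
    · rw [energyLIntegral_congr γ δ Ω (Lp.coeFn_smul c u)]
      refine (energyLIntegral_smul γ δ Ω c u).trans_lt ?_
      exact ENNReal.mul_lt_top ENNReal.ofReal_lt_top hu.1
    · filter_upwards [Lp.coeFn_smul c u, hu.2] with x hx h1 hxI
      rw [hx, Pi.smul_apply, h1 hxI, smul_zero]

/-- The energy inner product `a(u,v)`. -/
def energyInner (γ : DiffusionKernel d) (δ : ℝ) (Ω : Set (Euc d))
    (u v : energySpace γ δ Ω) : ℝ :=
  ∫ x in extendedDomain δ Ω, ∫ y in extendedDomain δ Ω,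
    γ.diff δ ‖y - x‖ * (u.1 y - u.1 x) * (v.1 y - v.1 x)

/-- The energy norm `a(u,u)^{1/2}`. -/
def energyNorm (γ : DiffusionKernel d) (δ : ℝ) (Ω : Set (Euc d)) (u : energySpace γ δ Ω) : ℝ :=
  Real.sqrt (energyInner γ δ Ω u u)

/-- The dual of the energy space: linear functionals bounded with respect to the energy norm. -/
def energyDual (γ : DiffusionKernel d) (δ : ℝ) (Ω : Set (Euc d)) :
    Submodule ℝ (Module.Dual ℝ (energySpace γ δ Ω)) where
  carrier := {ℓ | ∃ C : ℝ, ∀ φ, |ℓ φ| ≤ C * energyNorm γ δ Ω φ}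
  zero_mem' := ⟨0, fun φ => by simp⟩
  add_mem' := by
    rintro ℓ m ⟨C, hC⟩ ⟨D, hD⟩
    refine ⟨C + D, fun φ => ?_⟩
    calc |(ℓ + m) φ| ≤ |ℓ φ| + |m φ| := abs_add_le _ _
      _ ≤ (C + D) * energyNorm γ δ Ω φ := by linarith [hC φ, hD φ]
  smul_mem' := by
    rintro c ℓ ⟨C, hC⟩
    refine ⟨|c| * C, fun φ => ?_⟩
    rw [LinearMap.smul_apply, smul_eq_mul, abs_mul, mul_assoc]
    exact mul_le_mul_of_nonneg_left (hC φ) (abs_nonneg c)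

/-- The nonlocal gradient with influence regions `H x`:
`∫_{H x} (y - x)/|y - x| γconv_δ(|y - x|) (u(y) - u(x)) dy`. -/
def nlGradient (γ : DiffusionKernel d) (η δ : ℝ) (H : Euc d → Set (Euc d)) (u : Euc d → ℝ)
    (x : Euc d) : Euc d :=
  ∫ y in H x, (γ.conv η δ ‖y - x‖ * (u y - u x)) • ((1 / ‖y - x‖) • (y - x))

/-- The nonlocal diffusion operator with the singularity cut off at distance `r`:
`2 ∫_{B_δ(x), |y - x| > r} γ_δ(|y - x|) (u(y) - u(x)) dy`. -/
def nlDiffusionCut (γ : DiffusionKernel d) (δ r : ℝ) (u : Euc d → ℝ) (x : Euc d) : ℝ :=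
  2 * ∫ y in {y | y ∈ Metric.ball x δ ∧ r < ‖y - x‖}, γ.diff δ ‖y - x‖ * (u y - u x)

open Classical in
/-- The nonlocal divergence of a vector field `w` with the singularity cut off at distance `r`:
`∫_{|y - x| > r} (w(x) 1_{H x}(y) + w(y) 1_{H y}(x)) · (y - x)/|y - x| γconv_δ(|y - x|) dy`. -/
def nlDivergenceCut (γ : DiffusionKernel d) (η δ : ℝ) (H : Euc d → Set (Euc d)) (r : ℝ)
    (w : Euc d → Euc d) (x : Euc d) : ℝ :=
  ∫ y in {y | r < ‖y - x‖},
    inner ℝ ((if y ∈ H x then w x else 0) + (if x ∈ H y then w y else 0))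
      ((1 / ‖y - x‖) • (y - x)) * γ.conv η δ ‖y - x‖

/-- `ℓ` is the principal value, as `r ↓ 0`, of the functions `F r` on `Ω`, in the dual of the
energy space: `(F r, φ)_{L²(Ω)} → ℓ φ` for every `φ` in the energy space. (If the integral without
cut-off converges absolutely, dominated convergence identifies `ℓ` with that function.) -/
def IsPrincipalValue (γ : DiffusionKernel d) (δ : ℝ) (Ω : Set (Euc d)) (F : ℝ → Euc d → ℝ)
    (ℓ : energyDual γ δ Ω) : Prop :=
  ∀ φ : energySpace γ δ Ω,
    Tendsto (fun r => ∫ x in Ω, F r x * φ.1 x) (𝓝[>] 0) (𝓝 (ℓ.1 φ))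

/-- `(b · G_δ u, v)`, the inner product being that of `L²(Ω)`. -/
def convectionForm (γ : DiffusionKernel d) (η δ : ℝ) (Ω : Set (Euc d)) (b : Euc d → Euc d)
    (H : Euc d → Set (Euc d)) (u v : energySpace γ δ Ω) : ℝ :=
  ∫ x in Ω, inner ℝ (b x) (nlGradient γ η δ H u.1 x) * v.1 x

/-- The bilinear form `b(u,v) = ε a(u,v) + (b · G_δ u, v)`. -/
def bilin (γ : DiffusionKernel d) (η δ ε : ℝ) (Ω : Set (Euc d)) (b : Euc d → Euc d)
    (H : Euc d → Set (Euc d)) (u v : energySpace γ δ Ω) : ℝ :=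
  ε * energyInner γ δ Ω u v + convectionForm γ η δ Ω b H u v

/-- The quotients `|b(u,v)| / ‖u‖`; the quotient at `u = 0` is `0`. -/
def optQuotients (γ : DiffusionKernel d) (η δ ε : ℝ) (Ω : Set (Euc d)) (b : Euc d → Euc d)
    (H : Euc d → Set (Euc d)) (v : energySpace γ δ Ω) : Set ℝ :=
  range fun u : energySpace γ δ Ω => |bilin γ η δ ε Ω b H u v| / energyNorm γ δ Ω u

/-- The optimal test norm `sup_u |b(u,v)| / ‖u‖`. -/
def optNorm (γ : DiffusionKernel d) (η δ ε : ℝ) (Ω : Set (Euc d)) (b : Euc d → Euc d)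
    (H : Euc d → Set (Euc d)) (v : energySpace γ δ Ω) : ℝ :=
  sSup (optQuotients γ η δ ε Ω b H v)

/-- Constant velocity, and full balls as influence regions. -/
def ConstantFullBall (δ : ℝ) (b : Euc d → Euc d) (H : Euc d → Set (Euc d)) : Prop :=
  (∃ b₀ : Euc d, ∀ x, b x = b₀) ∧ ∀ x, H x = Metric.ball x δ

/-- Upwind hemispheres as influence regions, and a velocity field with `-D_δ(b) ≥ 0` on `Ω`
(tested against non-negative elements of the energy space). -/
def UpwindHemisphere (γ : DiffusionKernel d) (η δ : ℝ) (Ω : Set (Euc d)) (b : Euc d → Euc d)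
    (H : Euc d → Set (Euc d)) : Prop :=
  (∀ x, H x = {y | y ∈ Metric.ball x δ ∧ 0 < -inner ℝ (b x) (y - x)}) ∧
  ∃ ℓ : energyDual γ δ Ω,
    IsPrincipalValue γ δ Ω (fun r => nlDivergenceCut γ η δ H r b) ℓ ∧
    ∀ φ : energySpace γ δ Ω,
      (∀ᵐ x ∂(volume.restrict (extendedDomain δ Ω)), 0 ≤ φ.1 x) → 0 ≤ -ℓ.1 φ

end NonlocalConvection

end

/-! Everything is moved into one Hilbert space, `L²` of the measure `γ_δ(|y - x|) dx dy`
(`pairMeasure`), through the map `J` sending `u` to the jump `u(y) - u(x)` of its extension by zero.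
Since a point of `Ω` interacts only with points of `Ω_δ`, the energy form is `a(u,v) = ⟨J u, J v⟩`.
A nonlocal Poincaré inequality (`exists_poincare`) makes `J` injective with closed range, so Riesz
representation applies and `A w = a(w, ·)` is a bijection onto the dual (`exists_energyEquiv`).

The convection form is `∫ κ(x,y) v(x) (u(y) - u(x))` against the same measure, with `κ = 1_{H x}(y)
b(x) · (y - x) / η`. As `|κ| ≤ C |y - x|` and the kernel has a finite second moment, `κ(x,y) v(x)`
is in `L²`. Hence `D v = -(b · G_δ ·, v)` is in the dual. Away from the diagonal the jump may be
split into its two terms and the variables exchanged; letting the cut-off tend to `0` identifies `A`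
with `-L_δ` and `D v` with `D_δ(b v)`.

With `T v = ε v - A⁻¹ D v` one gets `b(u,v) = a(u, T v)`. By Cauchy–Schwarz, with equality at `u = T
v`, the optimal norm of `v` is the energy norm of `T v`, and expanding the square gives the formula.
Definiteness follows from `b(v,v) ≥ ε a(v,v)`, that is, `(b · G_δ v, v) ≥ 0`. In case (1) this form
vanishes, because `κ` is odd both under exchange of the variables and under reflection of `y` in
`x`. In case (2) `κ ≤ 0` and `v(x)(v(y) - v(x)) = ½(v(y)² - v(x)²) - ½(v(y) - v(x))²`: the first
term contributes `-½ D_δ(b)` tested on `v²`, the second is non-negative after multiplication by `κ`.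
A truncation ensures that `v²` is an admissible test function. -/

namespace NonlocalConvection

variable {d : ℕ}

/-! ### The extended domain, the kernel and the measure on pairs -/

theorem measurableSet_extendedDomain (δ : ℝ) {Ω : Set (Euc d)} (hΩo : IsOpen Ω) :
    MeasurableSet (extendedDomain δ Ω) :=
  hΩo.measurableSet.union (hΩo.measurableSet.compl.inter
    (measurableSet_lt measurable_infDist measurable_const))

/-- If `y ∉ Ω`, the segment from `x` to `y` meets the frontier by connectedness, at a point no
farther from `y` than `x` is. This is what allows integrals over `Ω_δ` to be replaced by integrals
over the whole space. -/
theorem mem_extendedDomain_of_dist_lt {δ : ℝ} {Ω : Set (Euc d)} (hΩo : IsOpen Ω) {x y : Euc d}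
    (hx : x ∈ Ω) (hxy : ‖y - x‖ < δ) : y ∈ extendedDomain δ Ω := by
  by_cases hy : y ∈ Ω
  · exact Or.inl hy
  refine Or.inr ⟨hy, ?_⟩
  obtain ⟨z, hz, hzf⟩ : ∃ z ∈ segment ℝ x y, z ∈ frontier Ω := by
    by_contra! h
    have hcl : ∀ z ∈ segment ℝ x y, z ∉ Ω → z ∉ closure Ω := fun z hz hzΩ hzc =>
      h z hz ⟨hzc, by rwa [hΩo.interior_eq]⟩
    obtain ⟨z, -, hz₁, hz₂⟩ := (convex_segment x y).isPreconnected Ω (closure Ω)ᶜ hΩo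
      isClosed_closure.isOpen_compl (fun z hz => or_iff_not_imp_left.2 (hcl z hz))
      ⟨x, left_mem_segment ℝ x y, hx⟩
      ⟨y, right_mem_segment ℝ x y, hcl y (right_mem_segment ℝ x y) hy⟩
    exact hz₂ (subset_closure hz₁)
  refine (Metric.infDist_le_dist_of_mem hzf).trans_lt (lt_of_le_of_lt ?_ hxy)
  obtain ⟨a, c, ha, hc, hac, rfl⟩ := hz
  have hcx : y - (a • x + c • y) = a • (y - x) := by
    rw [show y - (a • x + c • y) = (a + c) • y - (a • x + c • y) by rw [hac, one_smul]]
    module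
  rw [dist_eq_norm, hcx, norm_smul, Real.norm_of_nonneg ha]
  exact mul_le_of_le_one_left (norm_nonneg _) (by linarith)

theorem DiffusionKernel.diff_of_not_mem (γ : DiffusionKernel d) {δ r : ℝ} (h : r ∉ Ioc 0 δ) :
    γ.diff δ r = 0 := if_neg h

/-- Lets the diffusion and convection forms be integrated against the same measure on pairs. -/
theorem DiffusionKernel.conv_eq (γ : DiffusionKernel d) {δ : ℝ} (hδ : 0 < δ) (η r : ℝ) :
    γ.conv η δ r = r / η * γ.diff δ r := by
  unfold DiffusionKernel.conv DiffusionKernel.diff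
  split_ifs with h
  · rw [pow_succ δ (d + 1)]
    field_simp
  · simp

/-- The diffusion kernel has a finite second moment. -/
theorem DiffusionKernel.lintegral_moment_lt_top (γ : DiffusionKernel d) {δ : ℝ} (hδ : 0 < δ) :
    ∫⁻ z : Euc d, ENNReal.ofReal (γ.diff δ ‖z‖ * ‖z‖ ^ 2) < ⊤ := by
  have h1 : Integrable ((Metric.ball (0 : Euc d) 1).indicator
      fun s => γ.toFun ‖s‖ * ‖s‖ ^ 2) volume :=
    (integrable_indicator_iff Metric.isOpen_ball.measurableSet).2 γ.integrable_moment
  have h2 := ((integrable_comp_smul_iff volume _ (inv_ne_zero hδ.ne')).2 h1).const_mul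
    (1 / δ ^ (d + 2) * δ ^ 2)
  refine lt_of_eq_of_lt (lintegral_congr_ae ?_) h2.lintegral_lt_top
  -- The scaled kernel may be non-zero at radius `δ`, whereas the moment is taken over the open
  -- ball; the sphere between them is null.
  have hs : ∀ᵐ z : Euc d, z ∉ Metric.sphere (0 : Euc d) δ :=
    measure_eq_zero_iff_ae_notMem.1 (Measure.addHaar_sphere_of_ne_zero volume 0 hδ.ne')
  filter_upwards [hs] with z hz
  have hz' : ‖z‖ ≠ δ := by simpa using hz
  congr 1
  have hn : ‖δ⁻¹ • z‖ = ‖z‖ / δ := by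
    rw [norm_smul, norm_inv, Real.norm_of_nonneg hδ.le]; field_simp
  by_cases hlt : ‖z‖ < δ
  · have hm : δ⁻¹ • z ∈ Metric.ball (0 : Euc d) 1 := by
      rw [mem_ball_zero_iff, hn, div_lt_one hδ]; exact hlt
    rw [indicator_of_mem hm, hn]
    by_cases h0 : z = 0
    · simp [h0]
    · have : ‖z‖ ∈ Ioc 0 δ := ⟨norm_pos_iff.2 h0, hlt.le⟩
      rw [DiffusionKernel.diff, if_pos this]
      field_simp
  · have hm : δ⁻¹ • z ∉ Metric.ball (0 : Euc d) 1 := by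
      rw [mem_ball_zero_iff, hn, div_lt_one hδ]; exact hlt
    rw [indicator_of_notMem hm, γ.diff_of_not_mem (fun h => hlt (lt_of_le_of_ne h.2 hz'))]
    simp

/-- The kernel is positive at some radius, since otherwise its second moment would be `0` rather
than `d`; monotonicity carries this lower bound to all smaller radii. -/
theorem DiffusionKernel.exists_pos_le_diff (γ : DiffusionKernel d) (hd : 0 < d) {δ : ℝ}
    (hδ : 0 < δ) : ∃ c > 0, ∃ r₀ > 0, ∀ r ∈ Ioc 0 r₀, c ≤ γ.diff δ r := by
  obtain ⟨r₁, hr₁, hpos⟩ : ∃ r ∈ Ioc (0 : ℝ) 1, 0 < γ.toFun r := by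
    by_contra! h
    have h0 : ∫ s in Metric.ball (0 : Euc d) 1, γ.toFun ‖s‖ * ‖s‖ ^ 2 = 0 := by
      refine setIntegral_eq_zero_of_forall_eq_zero fun s hs => ?_
      rw [mem_ball_zero_iff] at hs
      by_cases hs0 : s = 0
      · simp [hs0]
      · have hm : ‖s‖ ∈ Ioc (0 : ℝ) 1 := ⟨norm_pos_iff.2 hs0, hs.le⟩
        rw [le_antisymm (h _ hm) (γ.nonneg _ hm), zero_mul]
    rw [γ.second_moment] at h0
    exact hd.ne' (by exact_mod_cast h0)
  refine ⟨1 / δ ^ (d + 2) * γ.toFun r₁, by positivity, δ * r₁, mul_pos hδ hr₁.1, fun r hr => ?_⟩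
  have hrδ : r / δ ≤ r₁ := by rw [div_le_iff₀ hδ, mul_comm]; exact hr.2
  have hm : r ∈ Ioc 0 δ := ⟨hr.1, hr.2.trans (mul_le_of_le_one_right hδ.le hr₁.2)⟩
  rw [DiffusionKernel.diff, if_pos hm]
  exact mul_le_mul_of_nonneg_left
    (γ.antitoneOn ⟨div_pos hr.1 hδ, hrδ.trans hr₁.2⟩ hr₁ hrδ) (by positivity)

/-- The measure `γ_δ(|y - x|) dx dy` on pairs of points. -/
noncomputable def pairMeasure (γ : DiffusionKernel d) (δ : ℝ) : Measure (Euc d × Euc d) :=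
  ((volume : Measure (Euc d)).prod volume).withDensity
    fun p => ENNReal.ofReal (γ.diff δ ‖p.2 - p.1‖)

theorem measurable_pairDensity (γ : DiffusionKernel d) (δ : ℝ) :
    Measurable fun p : Euc d × Euc d => γ.diff δ ‖p.2 - p.1‖ :=
  (γ.measurable_diff δ).comp (measurable_snd.sub measurable_fst).norm

theorem pairMeasure_absolutelyContinuous (γ : DiffusionKernel d) (δ : ℝ) :
    pairMeasure γ δ ≪ (volume : Measure (Euc d)).prod volume :=
  withDensity_absolutelyContinuous _ _

theorem lintegral_pairMeasure (γ : DiffusionKernel d) (δ : ℝ) (g : Euc d × Euc d → ENNReal) :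
    ∫⁻ p, g p ∂pairMeasure γ δ
      = ∫⁻ p, ENNReal.ofReal (γ.diff δ ‖p.2 - p.1‖) * g p
          ∂(volume : Measure (Euc d)).prod volume := by
  rw [pairMeasure, lintegral_withDensity_eq_lintegral_mul_non_measurable _
    (measurable_pairDensity γ δ).ennreal_ofReal (ae_of_all _ fun _ => ENNReal.ofReal_lt_top)]
  rfl

theorem integral_pairMeasure (γ : DiffusionKernel d) (δ : ℝ) (g : Euc d × Euc d → ℝ) :
    ∫ p, g p ∂pairMeasure γ δ
      = ∫ p, γ.diff δ ‖p.2 - p.1‖ * g p ∂(volume : Measure (Euc d)).prod volume := by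
  rw [pairMeasure, integral_withDensity_eq_integral_toReal_smul
    (measurable_pairDensity γ δ).ennreal_ofReal (ae_of_all _ fun _ => ENNReal.ofReal_lt_top)]
  refine integral_congr_ae (ae_of_all _ fun p => ?_)
  simp only [ENNReal.toReal_ofReal (γ.diff_nonneg δ _), smul_eq_mul]

theorem integrable_pairMeasure_iff (γ : DiffusionKernel d) (δ : ℝ) (g : Euc d × Euc d → ℝ) :
    Integrable g (pairMeasure γ δ) ↔
      Integrable (fun p => γ.diff δ ‖p.2 - p.1‖ * g p)
        ((volume : Measure (Euc d)).prod volume) := by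
  rw [pairMeasure, integrable_withDensity_iff_integrable_smul'
    (measurable_pairDensity γ δ).ennreal_ofReal (ae_of_all _ fun _ => ENNReal.ofReal_lt_top)]
  simp only [ENNReal.toReal_ofReal (γ.diff_nonneg δ _), smul_eq_mul]

theorem measurePreserving_swap_pairMeasure (γ : DiffusionKernel d) (δ : ℝ) :
    MeasurePreserving Prod.swap (pairMeasure γ δ) (pairMeasure γ δ) := by
  refine ⟨measurable_swap, ?_⟩
  ext s hs
  rw [Measure.map_apply measurable_swap hs, pairMeasure, withDensity_apply _ hs,
    withDensity_apply _ (measurable_swap hs)]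
  rw [← (Measure.measurePreserving_swap (μ := (volume : Measure (Euc d)))
    (ν := volume)).setLIntegral_comp_preimage hs (measurable_pairDensity γ δ).ennreal_ofReal]
  simp only [Prod.fst_swap, Prod.snd_swap, norm_sub_rev]

/-- The density vanishes on the diagonal and beyond distance `δ`, and spheres of radius `δ` are
null. -/
theorem ae_pairMeasure_norm_mem (γ : DiffusionKernel d) {δ : ℝ} (hδ : 0 < δ) :
    ∀ᵐ p ∂pairMeasure γ δ, 0 < ‖p.2 - p.1‖ ∧ ‖p.2 - p.1‖ < δ := by
  have h1 : ∀ᵐ p : Euc d × Euc d ∂(volume : Measure (Euc d)).prod volume, ‖p.2 - p.1‖ ≠ δ := by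
    refine (Measure.ae_prod_iff_ae_ae ?_).2 (ae_of_all _ fun x => ?_)
    · exact (measurable_snd.sub measurable_fst).norm (measurableSet_singleton δ).compl
    · have := measure_eq_zero_iff_ae_notMem.1
        (Measure.addHaar_sphere_of_ne_zero (volume : Measure (Euc d)) x hδ.ne')
      filter_upwards [this] with y hy
      simpa [dist_eq_norm] using hy
  rw [pairMeasure, ae_withDensity_iff (measurable_pairDensity γ δ).ennreal_ofReal]
  filter_upwards [h1] with p hp h0
  have hm : ‖p.2 - p.1‖ ∈ Ioc 0 δ := by
    by_contra hm
    exact h0 (by rw [γ.diff_of_not_mem hm, ENNReal.ofReal_zero])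
  exact ⟨hm.1, lt_of_le_of_ne hm.2 hp⟩

end NonlocalConvection

namespace NonlocalConvection

variable {d : ℕ}

/-! ### Square integrability on pairs and the Poincaré inequality -/

theorem enorm_sq_eq_ofReal_sq (a : ℝ) : ‖a‖ₑ ^ 2 = ENNReal.ofReal (a ^ 2) := by
  rw [Real.enorm_eq_ofReal_abs, ← ENNReal.ofReal_pow (abs_nonneg a), sq_abs]

theorem eLpNorm_two_sq {α : Type*} [MeasurableSpace α] {μ : Measure α} (f : α → ℝ) :
    eLpNorm f 2 μ ^ 2 = ∫⁻ x, ENNReal.ofReal (f x ^ 2) ∂μ := by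
  have h := eLpNorm_nnreal_pow_eq_lintegral (f := f) (μ := μ) (p := 2) two_ne_zero
  simp only [NNReal.coe_ofNat, ENNReal.coe_ofNat, ENNReal.rpow_ofNat] at h
  rw [h]
  exact lintegral_congr fun x => enorm_sq_eq_ofReal_sq _

theorem memLp_two_of_lintegral_sq_lt_top {α : Type*} [MeasurableSpace α] {μ : Measure α}
    {f : α → ℝ} (hf : AEStronglyMeasurable f μ)
    (h : ∫⁻ x, ENNReal.ofReal (f x ^ 2) ∂μ < ⊤) : MemLp f 2 μ := by
  refine ⟨hf, ?_⟩
  rw [← eLpNorm_two_sq] at h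
  exact lt_of_not_ge fun h' => by simp [top_le_iff.1 h'] at h

/-- The second moment of the diffusion kernel. -/
noncomputable def kernelMoment (γ : DiffusionKernel d) (δ : ℝ) : ENNReal :=
  ∫⁻ z : Euc d, ENNReal.ofReal (γ.diff δ ‖z‖ * ‖z‖ ^ 2)

theorem lintegral_prod_translate {F : Euc d → Euc d → ENNReal}
    (hF : Measurable (Function.uncurry F)) :
    ∫⁻ p, F (p.2 - p.1) p.1 ∂(volume : Measure (Euc d)).prod volume
      = ∫⁻ z, ∫⁻ x, F z x := by
  have hm : Measurable fun p : Euc d × Euc d => F (p.2 - p.1) p.1 :=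
    hF.comp ((measurable_snd.sub measurable_fst).prodMk measurable_fst)
  rw [lintegral_prod _ hm.aemeasurable, lintegral_lintegral_swap hF.aemeasurable]
  refine lintegral_congr fun x => ?_
  exact lintegral_sub_right_eq_self (fun z => F z x) x

/-- With `z = y - x` the integral factorises, and the weight `|z|²` tames the singularity of the
kernel. Without it `f(x)` need not be square integrable near the diagonal. -/
theorem lintegral_pairMeasure_weight (γ : DiffusionKernel d) (δ : ℝ) {f : Euc d → ℝ}
    (hf : Measurable f) :
    ∫⁻ p, ENNReal.ofReal ((‖p.2 - p.1‖ * f p.1) ^ 2) ∂pairMeasure γ δ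
      = kernelMoment γ δ * ∫⁻ x, ENNReal.ofReal (f x ^ 2) := by
  rw [lintegral_pairMeasure]
  have h1 : ∀ p : Euc d × Euc d, ENNReal.ofReal (γ.diff δ ‖p.2 - p.1‖)
      * ENNReal.ofReal ((‖p.2 - p.1‖ * f p.1) ^ 2)
      = ENNReal.ofReal (γ.diff δ ‖p.2 - p.1‖ * ‖p.2 - p.1‖ ^ 2)
        * ENNReal.ofReal (f p.1 ^ 2) := fun p => by
    rw [← ENNReal.ofReal_mul (γ.diff_nonneg _ _),
      ← ENNReal.ofReal_mul (mul_nonneg (γ.diff_nonneg _ _) (sq_nonneg _))]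
    congr 1
    ring
  have hz : Measurable fun z : Euc d => ENNReal.ofReal (γ.diff δ ‖z‖ * ‖z‖ ^ 2) :=
    (((γ.measurable_diff δ).comp measurable_norm).mul
      (measurable_norm.pow_const 2)).ennreal_ofReal
  have hx : Measurable fun x => ENNReal.ofReal (f x ^ 2) := (hf.pow_const 2).ennreal_ofReal
  rw [lintegral_congr h1, lintegral_prod_translate
    (F := fun z x => ENNReal.ofReal (γ.diff δ ‖z‖ * ‖z‖ ^ 2) * ENNReal.ofReal (f x ^ 2))
    ((hz.comp measurable_fst).mul (hx.comp measurable_snd))]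
  simp_rw [lintegral_const_mul _ hx]
  rw [lintegral_mul_const _ hz, kernelMoment]

theorem memLp_weight_mul_fst (γ : DiffusionKernel d) {δ : ℝ} (hδ : 0 < δ) {f : Euc d → ℝ}
    (hf : Measurable f) (hf2 : MemLp f 2 volume) :
    MemLp (fun p : Euc d × Euc d => ‖p.2 - p.1‖ * f p.1) 2 (pairMeasure γ δ) := by
  refine memLp_two_of_lintegral_sq_lt_top
    ((measurable_snd.sub measurable_fst).norm.mul (hf.comp measurable_fst)).aestronglyMeasurable ?_
  rw [lintegral_pairMeasure_weight γ δ hf, ← eLpNorm_two_sq]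
  exact ENNReal.mul_lt_top (γ.lintegral_moment_lt_top hδ) (ENNReal.pow_lt_top hf2.2)

/-- The difference `f(y) - f(x)`. -/
def jump (f : Euc d → ℝ) (p : Euc d × Euc d) : ℝ := f p.2 - f p.1

theorem measurable_jump {f : Euc d → ℝ} (hf : Measurable f) : Measurable (jump f) :=
  (hf.comp measurable_snd).sub (hf.comp measurable_fst)

/-- Telescoping: a shift by `n z` is `n` shifts by `z`, each costing the same by translation
invariance. -/
theorem eLpNorm_translate_sub_le {f : Euc d → ℝ} (hf : Measurable f) (z : Euc d) (n : ℕ) :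
    eLpNorm (fun x => f (x + (n : ℝ) • z) - f x) 2 volume
      ≤ n * eLpNorm (fun x => f (x + z) - f x) 2 volume := by
  have hm : ∀ w : Euc d, Measurable fun x => f (x + w) - f x := fun w =>
    (hf.comp (measurable_id.add_const w)).sub hf
  induction n with
  | zero => simp
  | succ n ih =>
    have h1 : eLpNorm (fun x => f (x + (n : ℝ) • z + z) - f (x + (n : ℝ) • z)) 2 volume
        = eLpNorm (fun x => f (x + z) - f x) 2 volume := by
      have h := eLpNorm_comp_measurePreserving (p := 2) (hm z).aestronglyMeasurable
        (measurePreserving_add_right volume ((n : ℝ) • z))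
      rw [← h, Function.comp_def]
    have h2 : (fun x => f (x + ((n + 1 : ℕ) : ℝ) • z) - f x)
        = (fun x => f (x + (n : ℝ) • z + z) - f (x + (n : ℝ) • z))
          + fun x => f (x + (n : ℝ) • z) - f x := by
      funext x
      simp only [Pi.add_apply, Nat.cast_succ, add_smul, one_smul, add_assoc]
      ring
    rw [h2]
    have hmz : Measurable fun x => f (x + (n : ℝ) • z + z) - f (x + (n : ℝ) • z) :=
      (hm z).comp (measurable_id.add_const ((n : ℝ) • z))
    refine (eLpNorm_add_le hmz.aestronglyMeasurable
      (hm _).aestronglyMeasurable (by norm_num)).trans ?_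
    rw [h1, Nat.cast_succ, add_mul, one_mul, add_comm]
    exact add_le_add_left ih _

/-- A nonlocal Poincaré inequality for functions vanishing outside a bounded set. -/
theorem exists_poincare (γ : DiffusionKernel d) (hd : 0 < d) {δ : ℝ} (hδ : 0 < δ)
    {Ω : Set (Euc d)} (hΩb : Bornology.IsBounded Ω) :
    ∃ C : ENNReal, C ≠ ⊤ ∧ ∀ f : Euc d → ℝ, Measurable f → (∀ x ∉ Ω, f x = 0) →
      eLpNorm f 2 volume ^ 2 ≤ C * ∫⁻ p, ENNReal.ofReal (jump f p ^ 2) ∂pairMeasure γ δ := by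
  have : Nonempty (Fin d) := ⟨⟨0, hd⟩⟩
  obtain ⟨c, hc, r₀, hr₀, hcr⟩ := γ.exists_pos_le_diff hd hδ
  obtain ⟨R, hR⟩ := hΩb.subset_closedBall 0
  obtain ⟨z₀, hz₀⟩ := NormedSpace.exists_lt_norm ℝ (Euc d) 0
  -- The ball of radius `r₀/4` about `z₁` lies in the shell `r₀/2 < ‖z‖ < r₀`: short enough for the
  -- lower bound on the kernel, long enough for boundedly many steps to leave `Ω`.
  obtain ⟨z₁, hz₁⟩ : ∃ z₁ : Euc d, ‖z₁‖ = 3 / 4 * r₀ :=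
    ⟨(3 / 4 * r₀ / ‖z₀‖) • z₀, by
      rw [norm_smul, Real.norm_of_nonneg (by positivity), div_mul_cancel₀ _ hz₀.ne']⟩
  -- This makes `n ‖z‖ > 2 |R|` on that shell, so a shift by `n z` carries every point of `Ω` out of
  -- `Ω`.
  obtain ⟨n, hn⟩ := exists_nat_gt (4 * |R| / r₀)
  have hn0 : 0 < n := by
    have : (0 : ℝ) < n := lt_of_le_of_lt (by positivity) hn
    exact_mod_cast this
  set B := Metric.ball z₁ (r₀ / 4) with hB
  have hBz : ∀ z ∈ B, r₀ / 2 < ‖z‖ ∧ ‖z‖ < r₀ := fun z hz => by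
    rw [hB, mem_ball_iff_norm] at hz
    have h1 := abs_lt.1 ((abs_norm_sub_norm_le z z₁).trans_lt hz)
    constructor <;> linarith [h1.1, h1.2]
  have hK0 : ENNReal.ofReal c * volume B ≠ 0 :=
    mul_ne_zero (ENNReal.ofReal_pos.2 hc).ne' (Metric.measure_ball_pos volume _ (by positivity)).ne'
  have hKt : ENNReal.ofReal c * volume B ≠ ⊤ :=
    ENNReal.mul_ne_top ENNReal.ofReal_ne_top measure_ball_lt_top.ne
  refine ⟨(n : ENNReal) ^ 2 * (ENNReal.ofReal c * volume B)⁻¹,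
    ENNReal.mul_ne_top (ENNReal.pow_ne_top (ENNReal.natCast_ne_top n))
      (ENNReal.inv_ne_top.2 hK0), fun f hf hf0 => ?_⟩
  -- For `x ∈ Ω` the value `f (x + n z)` is zero, so `|f x|` is itself an `n`-step increment.
  have hG : ∀ z ∈ B, eLpNorm f 2 volume ^ 2
      ≤ (n : ENNReal) ^ 2 * ∫⁻ x, ENNReal.ofReal ((f (x + z) - f x) ^ 2) := fun z hz => by
    rw [← eLpNorm_two_sq, ← mul_pow]
    refine pow_le_pow_left₀ zero_le (le_trans ?_ (eLpNorm_translate_sub_le hf z n)) 2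
    refine eLpNorm_mono fun x => ?_
    by_cases hx : x ∈ Ω
    · have hxn : x + (n : ℝ) • z ∉ Ω := fun hx' => by
        have h1 := mem_closedBall_zero_iff.1 (hR hx)
        have h2 := mem_closedBall_zero_iff.1 (hR hx')
        have h3 : ‖(n : ℝ) • z‖ ≤ 2 * |R| := by
          calc ‖(n : ℝ) • z‖ = ‖x + (n : ℝ) • z - x‖ := by rw [add_sub_cancel_left]
            _ ≤ ‖x + (n : ℝ) • z‖ + ‖x‖ := norm_sub_le _ _
            _ ≤ 2 * |R| := by linarith [le_abs_self R]
        rw [norm_smul, Real.norm_natCast] at h3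
        rw [div_lt_iff₀ hr₀] at hn
        have hn' : (0 : ℝ) < n := by exact_mod_cast hn0
        nlinarith [mul_lt_mul_of_pos_left (hBz z hz).1 hn']
      rw [hf0 _ hxn, zero_sub, norm_neg]
    · rw [hf0 x hx, norm_zero]
      exact norm_nonneg _
  have hE : ∫⁻ p, ENNReal.ofReal (jump f p ^ 2) ∂pairMeasure γ δ
      = ∫⁻ z : Euc d, ENNReal.ofReal (γ.diff δ ‖z‖)
          * ∫⁻ x, ENNReal.ofReal ((f (x + z) - f x) ^ 2) := by
    have hi : Measurable fun q : Euc d × Euc d => ENNReal.ofReal ((f (q.2 + q.1) - f q.2) ^ 2) :=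
      (((hf.comp (measurable_snd.add measurable_fst)).sub
        (hf.comp measurable_snd)).pow_const 2).ennreal_ofReal
    rw [lintegral_pairMeasure]
    have h := lintegral_prod_translate (F := fun z x : Euc d => ENNReal.ofReal (γ.diff δ ‖z‖)
      * ENNReal.ofReal ((f (x + z) - f x) ^ 2))
      ((((γ.measurable_diff δ).comp measurable_norm).ennreal_ofReal.comp measurable_fst).mul hi)
    simp only [add_sub_cancel] at h
    rw [show (fun p : Euc d × Euc d => ENNReal.ofReal (γ.diff δ ‖p.2 - p.1‖)
      * ENNReal.ofReal (jump f p ^ 2)) = fun p => ENNReal.ofReal (γ.diff δ ‖p.2 - p.1‖)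
      * ENNReal.ofReal ((f p.2 - f p.1) ^ 2) from rfl, h]
    refine lintegral_congr fun z => ?_
    rw [lintegral_const_mul' _ _ ENNReal.ofReal_ne_top]
  -- Integrate the bound for a single `z` over `B`, where the kernel is at least `c`.
  have hlow : ENNReal.ofReal c * volume B * eLpNorm f 2 volume ^ 2
      ≤ (n : ENNReal) ^ 2 * ∫⁻ p, ENNReal.ofReal (jump f p ^ 2) ∂pairMeasure γ δ := by
    rw [hE, ← lintegral_const_mul' _ _ (ENNReal.pow_ne_top (ENNReal.natCast_ne_top n))]
    calc ENNReal.ofReal c * volume B * eLpNorm f 2 volume ^ 2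
        = ∫⁻ _ in B, ENNReal.ofReal c * eLpNorm f 2 volume ^ 2 := by
          rw [setLIntegral_const]; ring
      _ ≤ ∫⁻ z in B, (n : ENNReal) ^ 2 * (ENNReal.ofReal (γ.diff δ ‖z‖)
          * ∫⁻ x, ENNReal.ofReal ((f (x + z) - f x) ^ 2)) := by
          refine setLIntegral_mono' Metric.isOpen_ball.measurableSet fun z hz => ?_
          rw [mul_left_comm]
          refine mul_le_mul' (ENNReal.ofReal_le_ofReal (hcr _ ⟨?_, (hBz z hz).2.le⟩)) (hG z hz)
          linarith [(hBz z hz).1]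
      _ ≤ _ := setLIntegral_le_lintegral _ _
  calc eLpNorm f 2 volume ^ 2
      = (ENNReal.ofReal c * volume B)⁻¹
        * (ENNReal.ofReal c * volume B * eLpNorm f 2 volume ^ 2) := by
        rw [← mul_assoc, ENNReal.inv_mul_cancel hK0 hKt, one_mul]
    _ ≤ (ENNReal.ofReal c * volume B)⁻¹ * _ := mul_le_mul_right hlow _
    _ = _ := by ring

/-! ### Extension by zero and the energy as an integral over all pairs -/

/-- The extension by zero of the restriction of `u` to `Ω`. -/
noncomputable def zeroExtension {γ : DiffusionKernel d} {δ : ℝ} {Ω : Set (Euc d)}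
    (u : energySpace γ δ Ω) : Euc d → ℝ := Ω.indicator u.1

section ZeroExtension

variable {γ : DiffusionKernel d} {δ : ℝ} {Ω : Set (Euc d)}

theorem measurable_zeroExtension (hΩo : IsOpen Ω) (u : energySpace γ δ Ω) :
    Measurable (zeroExtension u) :=
  (Lp.stronglyMeasurable u.1).measurable.indicator hΩo.measurableSet

theorem zeroExtension_of_notMem (u : energySpace γ δ Ω) {x : Euc d} (hx : x ∉ Ω) :
    zeroExtension u x = 0 := indicator_of_notMem hx _

theorem zeroExtension_of_mem (u : energySpace γ δ Ω) {x : Euc d} (hx : x ∈ Ω) :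
    zeroExtension u x = u.1 x := indicator_of_mem hx _

theorem ae_eq_zeroExtension (hΩo : IsOpen Ω) (u : energySpace γ δ Ω) :
    ∀ᵐ x ∂(volume.restrict (extendedDomain δ Ω)), u.1 x = zeroExtension u x := by
  filter_upwards [u.2.2, ae_restrict_mem (measurableSet_extendedDomain δ hΩo)] with x hx hm
  by_cases hxΩ : x ∈ Ω
  · rw [zeroExtension_of_mem u hxΩ]
  · rw [zeroExtension_of_notMem u hxΩ, hx (hm.resolve_left hxΩ)]

theorem memLp_zeroExtension (hΩo : IsOpen Ω) (u : energySpace γ δ Ω) :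
    MemLp (zeroExtension u) 2 volume :=
  (memLp_indicator_iff_restrict hΩo.measurableSet).2
    ((Lp.memLp u.1).mono_measure (Measure.restrict_mono_set _ subset_union_left))

theorem ae_pairMeasure_notMem (hΩo : IsOpen Ω) (hδ : 0 < δ) :
    ∀ᵐ p ∂pairMeasure γ δ, p ∉ extendedDomain δ Ω ×ˢ extendedDomain δ Ω → p.1 ∉ Ω ∧ p.2 ∉ Ω := by
  filter_upwards [ae_pairMeasure_norm_mem γ hδ] with p hp hn
  refine ⟨fun h => hn ⟨Or.inl h, mem_extendedDomain_of_dist_lt hΩo h hp.2⟩, fun h => hn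
    ⟨mem_extendedDomain_of_dist_lt hΩo h (by rw [norm_sub_rev]; exact hp.2), Or.inl h⟩⟩

/-- Almost every interacting pair outside `Ω_δ × Ω_δ` has both points off `Ω`, where `f` vanishes,
so enlarging the domain of integration adds nothing. -/
theorem energyLIntegral_eq (hΩo : IsOpen Ω) (hδ : 0 < δ) {f : Euc d → ℝ} (hf : Measurable f)
    (hf0 : ∀ x ∉ Ω, f x = 0) :
    energyLIntegral γ δ Ω f = ∫⁻ p, ENNReal.ofReal (jump f p ^ 2) ∂pairMeasure γ δ := by
  have hS := measurableSet_extendedDomain δ hΩo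
  have hm : Measurable fun p : Euc d × Euc d =>
      ENNReal.ofReal (γ.diff δ ‖p.2 - p.1‖ * (f p.2 - f p.1) ^ 2) :=
    ((measurable_pairDensity γ δ).mul ((measurable_jump hf).pow_const 2)).ennreal_ofReal
  unfold energyLIntegral
  rw [← lintegral_prod (fun p : Euc d × Euc d =>
      ENNReal.ofReal (γ.diff δ ‖p.2 - p.1‖ * (f p.2 - f p.1) ^ 2)) hm.aemeasurable,
    Measure.prod_restrict]
  have h1 : ∀ᵐ p ∂pairMeasure γ δ, ENNReal.ofReal (jump f p ^ 2)
      = (extendedDomain δ Ω ×ˢ extendedDomain δ Ω).indicator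
        (fun p => ENNReal.ofReal (jump f p ^ 2)) p := by
    filter_upwards [ae_pairMeasure_notMem hΩo hδ] with p hp
    by_cases hm : p ∈ extendedDomain δ Ω ×ˢ extendedDomain δ Ω
    · rw [indicator_of_mem hm]
    · rw [indicator_of_notMem hm, jump, hf0 _ (hp hm).1, hf0 _ (hp hm).2]
      simp
  rw [lintegral_congr_ae h1, lintegral_pairMeasure, ← lintegral_indicator (hS.prod hS)]
  refine lintegral_congr fun p => ?_
  by_cases hm : p ∈ extendedDomain δ Ω ×ˢ extendedDomain δ Ω
  · rw [indicator_of_mem hm, indicator_of_mem hm, ENNReal.ofReal_mul (γ.diff_nonneg _ _), jump]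
  · rw [indicator_of_notMem hm, indicator_of_notMem hm, mul_zero]

theorem memLp_jump_zeroExtension (hΩo : IsOpen Ω) (hδ : 0 < δ) (u : energySpace γ δ Ω) :
    MemLp (jump (zeroExtension u)) 2 (pairMeasure γ δ) := by
  refine memLp_two_of_lintegral_sq_lt_top
    (measurable_jump (measurable_zeroExtension hΩo u)).aestronglyMeasurable ?_
  rw [← energyLIntegral_eq hΩo hδ (measurable_zeroExtension hΩo u)
    fun x => zeroExtension_of_notMem u, ← energyLIntegral_congr γ δ Ω (ae_eq_zeroExtension hΩo u)]
  exact u.2.1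

/-- The way to construct elements of the energy space: it supplies the limit in the closed-range
argument and the squares used as test functions in the upwind case. -/
theorem exists_zeroExtension_eq (hΩo : IsOpen Ω) (hδ : 0 < δ) {f : Euc d → ℝ}
    (hf : Measurable f) (hf0 : ∀ x ∉ Ω, f x = 0) (hf2 : MemLp f 2 volume)
    (hJ : MemLp (jump f) 2 (pairMeasure γ δ)) :
    ∃ u : energySpace γ δ Ω, u.1 =ᵐ[volume.restrict (extendedDomain δ Ω)] f ∧
      zeroExtension u =ᵐ[volume] f := by
  have h2 : MemLp f 2 (volume.restrict (extendedDomain δ Ω)) := hf2.restrict _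
  refine ⟨⟨h2.toLp f, ?_, ?_⟩, h2.coeFn_toLp, ?_⟩
  · rw [energyLIntegral_congr γ δ Ω h2.coeFn_toLp, energyLIntegral_eq hΩo hδ hf hf0,
      ← eLpNorm_two_sq]
    exact ENNReal.pow_lt_top hJ.2
  · filter_upwards [h2.coeFn_toLp] with x hx hI
    rw [hx, hf0 x hI.1]
  · have h3 := ae_restrict_of_ae_restrict_of_subset
      (subset_union_left (s := Ω) (t := interactionDomain δ Ω)) h2.coeFn_toLp
    rw [ae_restrict_iff' hΩo.measurableSet] at h3
    filter_upwards [h3] with x hx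
    by_cases hxΩ : x ∈ Ω
    · rw [zeroExtension_of_mem _ hxΩ]
      exact hx hxΩ
    · rw [zeroExtension_of_notMem _ hxΩ, hf0 x hxΩ]

theorem energyInner_eq (hΩo : IsOpen Ω) (hδ : 0 < δ) (u v : energySpace γ δ Ω) :
    energyInner γ δ Ω u v
      = ∫ p, jump (zeroExtension u) p * jump (zeroExtension v) p ∂pairMeasure γ δ := by
  have hS := measurableSet_extendedDomain δ hΩo
  have hint : Integrable (fun p => jump (zeroExtension u) p * jump (zeroExtension v) p)
      (pairMeasure γ δ) :=
    (memLp_jump_zeroExtension hΩo hδ u).integrable_mul (memLp_jump_zeroExtension hΩo hδ v)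
  have h1 : energyInner γ δ Ω u v = ∫ x in extendedDomain δ Ω, ∫ y in extendedDomain δ Ω,
      γ.diff δ ‖y - x‖ * (jump (zeroExtension u) (x, y) * jump (zeroExtension v) (x, y)) := by
    refine integral_congr_ae ?_
    filter_upwards [ae_eq_zeroExtension hΩo u, ae_eq_zeroExtension hΩo v] with x hux hvx
    refine integral_congr_ae ?_
    filter_upwards [ae_eq_zeroExtension hΩo u, ae_eq_zeroExtension hΩo v] with y huy hvy
    simp only [jump, hux, huy, hvx, hvy]
    ring
  rw [h1, ← integral_prod (fun p : Euc d × Euc d => γ.diff δ ‖p.2 - p.1‖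
    * (jump (zeroExtension u) p * jump (zeroExtension v) p)), Measure.prod_restrict,
    integral_pairMeasure]
  · refine setIntegral_eq_integral_of_ae_compl_eq_zero ?_
    have := ae_pairMeasure_notMem (γ := γ) hΩo hδ
    rw [pairMeasure, ae_withDensity_iff (measurable_pairDensity γ δ).ennreal_ofReal] at this
    filter_upwards [this] with p hp hn
    by_cases h0 : γ.diff δ ‖p.2 - p.1‖ = 0
    · rw [h0, zero_mul]
    · have := hp (ENNReal.ofReal_pos.2 (lt_of_le_of_ne (γ.diff_nonneg _ _) (Ne.symm h0))).ne' hn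
      rw [jump, jump, zeroExtension_of_notMem u this.1, zeroExtension_of_notMem u this.2]
      ring
  · rw [Measure.prod_restrict]
    exact ((integrable_pairMeasure_iff γ δ _).1 hint).integrableOn

end ZeroExtension

end NonlocalConvection

namespace NonlocalConvection

variable {d : ℕ}

/-! ### The energy space as a Hilbert space and Riesz representation -/

theorem ae_fst_pairMeasure (γ : DiffusionKernel d) (δ : ℝ) {P : Euc d → Prop}
    (h : ∀ᵐ x, P x) : ∀ᵐ p ∂pairMeasure γ δ, P p.1 :=
  (pairMeasure_absolutelyContinuous γ δ).ae_le (Measure.quasiMeasurePreserving_fst.ae h)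

theorem ae_snd_pairMeasure (γ : DiffusionKernel d) (δ : ℝ) {P : Euc d → Prop}
    (h : ∀ᵐ x, P x) : ∀ᵐ p ∂pairMeasure γ δ, P p.2 :=
  (pairMeasure_absolutelyContinuous γ δ).ae_le (Measure.quasiMeasurePreserving_snd.ae h)

theorem jump_congr_ae (γ : DiffusionKernel d) (δ : ℝ) {f g : Euc d → ℝ} (h : f =ᵐ[volume] g) :
    jump f =ᵐ[pairMeasure γ δ] jump g := by
  filter_upwards [ae_fst_pairMeasure γ δ h, ae_snd_pairMeasure γ δ h] with p h1 h2
  rw [jump, jump, h1, h2]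

variable {γ : DiffusionKernel d} {δ : ℝ} {Ω : Set (Euc d)}

theorem ae_restrict_self_of_ae_extended (hΩo : IsOpen Ω) {P : Euc d → Prop}
    (h : ∀ᵐ x ∂(volume.restrict (extendedDomain δ Ω)), P x) : ∀ᵐ x, x ∈ Ω → P x :=
  (ae_restrict_iff' hΩo.measurableSet).1
    (ae_restrict_of_ae_restrict_of_subset subset_union_left h)

theorem zeroExtension_add (hΩo : IsOpen Ω) (u v : energySpace γ δ Ω) :
    ∀ᵐ x, zeroExtension (u + v) x = zeroExtension u x + zeroExtension v x := by
  filter_upwards [ae_restrict_self_of_ae_extended hΩo (Lp.coeFn_add u.1 v.1)] with x hx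
  by_cases hxΩ : x ∈ Ω
  · simp only [zeroExtension_of_mem _ hxΩ]
    exact hx hxΩ
  · simp only [zeroExtension_of_notMem _ hxΩ, add_zero]

theorem zeroExtension_smul (hΩo : IsOpen Ω) (c : ℝ) (u : energySpace γ δ Ω) :
    ∀ᵐ x, zeroExtension (c • u) x = c * zeroExtension u x := by
  filter_upwards [ae_restrict_self_of_ae_extended hΩo (Lp.coeFn_smul c u.1)] with x hx
  by_cases hxΩ : x ∈ Ω
  · simp only [zeroExtension_of_mem _ hxΩ]
    exact hx hxΩ
  · simp only [zeroExtension_of_notMem _ hxΩ, mul_zero]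

/-- The linear map `u ↦ u(y) - u(x)` from the energy space into `L²` of the pair measure. -/
noncomputable def jumpMap (hΩo : IsOpen Ω) (hδ : 0 < δ) :
    energySpace γ δ Ω →ₗ[ℝ] Lp ℝ 2 (pairMeasure γ δ) where
  toFun u := (memLp_jump_zeroExtension hΩo hδ u).toLp _
  map_add' u v := by
    rw [← MemLp.toLp_add]
    refine MemLp.toLp_congr _ _ ((jump_congr_ae γ δ (zeroExtension_add hΩo u v)).trans
      (ae_of_all _ fun p => ?_))
    simp only [jump, Pi.add_apply]
    ring
  map_smul' c u := by
    rw [RingHom.id_apply, ← MemLp.toLp_const_smul]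
    refine MemLp.toLp_congr _ _ ((jump_congr_ae γ δ (zeroExtension_smul hΩo c u)).trans
      (ae_of_all _ fun p => ?_))
    simp only [jump, Pi.smul_apply, smul_eq_mul]
    ring

/-- Extension by zero as a linear map into `L²`. -/
noncomputable def zeroExtensionMap (hΩo : IsOpen Ω) :
    energySpace γ δ Ω →ₗ[ℝ] Lp ℝ 2 (volume : Measure (Euc d)) where
  toFun u := (memLp_zeroExtension hΩo u).toLp _
  map_add' u v := by
    rw [← MemLp.toLp_add]
    exact MemLp.toLp_congr _ _ (zeroExtension_add hΩo u v)
  map_smul' c u := by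
    rw [RingHom.id_apply, ← MemLp.toLp_const_smul]
    exact MemLp.toLp_congr _ _ (zeroExtension_smul hΩo c u)

theorem coeFn_jumpMap (hΩo : IsOpen Ω) (hδ : 0 < δ) (u : energySpace γ δ Ω) :
    jumpMap hΩo hδ u =ᵐ[pairMeasure γ δ] jump (zeroExtension u) :=
  (memLp_jump_zeroExtension hΩo hδ u).coeFn_toLp

theorem coeFn_zeroExtensionMap (hΩo : IsOpen Ω) (u : energySpace γ δ Ω) :
    zeroExtensionMap hΩo u =ᵐ[volume] zeroExtension u :=
  (memLp_zeroExtension hΩo u).coeFn_toLp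

theorem inner_jumpMap (hΩo : IsOpen Ω) (hδ : 0 < δ) (u v : energySpace γ δ Ω) :
    inner ℝ (jumpMap hΩo hδ u) (jumpMap hΩo hδ v) = energyInner γ δ Ω u v := by
  rw [energyInner_eq hΩo hδ, L2.inner_def]
  refine integral_congr_ae ?_
  filter_upwards [coeFn_jumpMap hΩo hδ u, coeFn_jumpMap hΩo hδ v] with p hu hv
  rw [hu, hv]
  simp [mul_comm]

theorem norm_jumpMap (hΩo : IsOpen Ω) (hδ : 0 < δ) (u : energySpace γ δ Ω) :
    ‖jumpMap hΩo hδ u‖ = energyNorm γ δ Ω u := by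
  rw [energyNorm, ← inner_jumpMap hΩo hδ, real_inner_self_eq_norm_sq, Real.sqrt_sq (norm_nonneg _)]

theorem exists_norm_zeroExtensionMap_le (hd : 0 < d) (hΩo : IsOpen Ω)
    (hΩb : Bornology.IsBounded Ω) (hδ : 0 < δ) :
    ∃ C : ℝ, 0 ≤ C ∧ ∀ u : energySpace γ δ Ω,
      ‖zeroExtensionMap hΩo u‖ ≤ C * ‖jumpMap hΩo hδ u‖ := by
  obtain ⟨C, hC, h⟩ := exists_poincare γ hd hδ hΩb
  refine ⟨Real.sqrt C.toReal, Real.sqrt_nonneg _, fun u => ?_⟩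
  have h1 := h _ (measurable_zeroExtension hΩo u) fun x => zeroExtension_of_notMem u
  rw [← eLpNorm_two_sq] at h1
  have hfin : C * eLpNorm (jump (zeroExtension u)) 2 (pairMeasure γ δ) ^ 2 ≠ ⊤ :=
    ENNReal.mul_ne_top hC (ENNReal.pow_ne_top (memLp_jump_zeroExtension hΩo hδ u).2.ne)
  have h2 := ENNReal.toReal_mono hfin h1
  rw [ENNReal.toReal_mul, ENNReal.toReal_pow, ENNReal.toReal_pow] at h2
  refine le_of_sq_le_sq ?_ (by positivity)
  rw [mul_pow, Real.sq_sqrt ENNReal.toReal_nonneg]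
  simpa only [zeroExtensionMap, jumpMap, LinearMap.coe_mk, AddHom.coe_mk, Lp.norm_toLp] using h2

theorem jumpMap_injective (hd : 0 < d) (hΩo : IsOpen Ω) (hΩb : Bornology.IsBounded Ω)
    (hδ : 0 < δ) : Function.Injective (jumpMap (γ := γ) hΩo hδ) := by
  obtain ⟨C, -, hC⟩ := exists_norm_zeroExtensionMap_le (γ := γ) hd hΩo hΩb hδ
  rw [injective_iff_map_eq_zero]
  intro u hu
  have h1 : zeroExtensionMap hΩo u = 0 := by
    have := hC u
    rw [hu, norm_zero, mul_zero] at this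
    exact norm_le_zero_iff.1 this
  have h2 : zeroExtension u =ᵐ[volume] 0 := by
    have := coeFn_zeroExtensionMap hΩo u
    rw [h1] at this
    exact this.symm.trans (Lp.coeFn_zero ℝ 2 volume)
  refine Subtype.ext (Lp.ext ?_)
  filter_upwards [ae_eq_zeroExtension hΩo u, ae_restrict_of_ae h2,
    Lp.coeFn_zero ℝ 2 (volume.restrict (extendedDomain δ Ω))] with x hx h0 hz
  rw [hx, h0]
  exact hz.symm

/-- When the jumps converge, Poincaré makes the functions themselves Cauchy in `L²`; pointwise
convergence along a subsequence then shows that the limit of the jumps is the jump of the limit. -/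
theorem isClosed_range_jumpMap (hd : 0 < d) (hΩo : IsOpen Ω) (hΩb : Bornology.IsBounded Ω)
    (hδ : 0 < δ) : IsClosed (LinearMap.range (jumpMap (γ := γ) hΩo hδ) : Set
      (Lp ℝ 2 (pairMeasure γ δ))) := by
  obtain ⟨C, hC0, hC⟩ := exists_norm_zeroExtensionMap_le (γ := γ) hd hΩo hΩb hδ
  refine IsSeqClosed.isClosed fun s F hs hF => ?_
  choose u hu using hs
  have hcau : CauchySeq fun n => zeroExtensionMap hΩo (u n) := by
    have hs' := hF.cauchySeq
    rw [Metric.cauchySeq_iff'] at hs' ⊢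
    intro ε hε
    -- `C + 1` is used because `C` may be zero.
    obtain ⟨N, hN⟩ := hs' (ε / (C + 1)) (by positivity)
    refine ⟨N, fun n hn => ?_⟩
    have h1 := hN n hn
    rw [dist_eq_norm, ← hu, ← hu, ← map_sub, lt_div_iff₀ (by positivity)] at h1
    rw [dist_eq_norm, ← map_sub]
    nlinarith [hC (u n - u N), norm_nonneg (jumpMap hΩo hδ (u n - u N))]
  obtain ⟨g, hg⟩ := cauchySeq_tendsto_of_complete hcau
  -- Two successive extractions: along `n₁` the jumps converge a.e., along `n₁ ∘ n₂` the functions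
  -- do as well.
  obtain ⟨n₁, hn₁, hF'⟩ := (tendstoInMeasure_of_tendsto_Lp hF).exists_seq_tendsto_ae
  obtain ⟨n₂, hn₂, hg'⟩ :=
    (tendstoInMeasure_of_tendsto_Lp (hg.comp hn₁.tendsto_atTop)).exists_seq_tendsto_ae
  -- The indicator gives a representative of the limit that vanishes everywhere off `Ω`.
  have hgf : ∀ᵐ x, Tendsto (fun k => zeroExtension (u (n₁ (n₂ k))) x) atTop
      (𝓝 (Ω.indicator g x)) := by
    have hall : ∀ᵐ x, ∀ n, zeroExtensionMap hΩo (u n) x = zeroExtension (u n) x :=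
      ae_all_iff.2 fun n => coeFn_zeroExtensionMap hΩo (u n)
    filter_upwards [hg', hall] with x hx hax
    by_cases hxΩ : x ∈ Ω
    · rw [indicator_of_mem hxΩ]
      simpa only [Function.comp_apply, hax] using hx
    · simp only [indicator_of_notMem hxΩ, zeroExtension_of_notMem _ hxΩ, tendsto_const_nhds]
  have hJF : jump (Ω.indicator g) =ᵐ[pairMeasure γ δ] F := by
    have hall : ∀ᵐ p ∂pairMeasure γ δ, ∀ n, s n p = jump (zeroExtension (u n)) p :=
      ae_all_iff.2 fun n => by rw [← hu]; exact coeFn_jumpMap hΩo hδ (u n)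
    filter_upwards [hF', hall, ae_fst_pairMeasure γ δ hgf, ae_snd_pairMeasure γ δ hgf]
      with p h1 h2 h3 h4
    refine tendsto_nhds_unique (h4.sub h3) ?_
    have h5 := h1.comp hn₂.tendsto_atTop
    simpa only [Function.comp_def, h2, jump] using h5
  have hgm : Measurable (Ω.indicator g) :=
    (Lp.stronglyMeasurable g).measurable.indicator hΩo.measurableSet
  obtain ⟨w, -, hw⟩ := exists_zeroExtension_eq hΩo hδ hgm (fun x hx => indicator_of_notMem hx _)
    ((Lp.memLp g).indicator hΩo.measurableSet) ((memLp_congr_ae hJF).2 (Lp.memLp F))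
  refine ⟨w, Lp.ext ?_⟩
  exact (coeFn_jumpMap hΩo hδ w).trans ((jump_congr_ae γ δ hw).trans hJF)

/-- The closed range of `J` is complete and isometric to the energy space, so the functional is
transported there, represented, and pulled back. -/
theorem exists_riesz (hd : 0 < d) (hΩo : IsOpen Ω) (hΩb : Bornology.IsBounded Ω) (hδ : 0 < δ)
    (ℓ : energyDual γ δ Ω) : ∃ w, ∀ φ, energyInner γ δ Ω w φ = ℓ.1 φ := by
  set J := jumpMap (γ := γ) hΩo hδ with hJ
  let e := LinearEquiv.ofInjective J (jumpMap_injective hd hΩo hΩb hδ)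
  have : CompleteSpace (LinearMap.range J) :=
    (isClosed_range_jumpMap hd hΩo hΩb hδ).completeSpace_coe
  obtain ⟨C, hC⟩ := ℓ.2
  let L : LinearMap.range J →L[ℝ] ℝ := (ℓ.1 ∘ₗ e.symm.toLinearMap).mkContinuous C fun x => by
    obtain ⟨φ, rfl⟩ := e.surjective x
    have h1 : ‖e φ‖ = energyNorm γ δ Ω φ := norm_jumpMap hΩo hδ φ
    simpa [h1] using hC φ
  obtain ⟨w, hw⟩ := e.surjective ((InnerProductSpace.toDual ℝ (LinearMap.range J)).symm L)
  refine ⟨w, fun φ => ?_⟩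
  have h1 := InnerProductSpace.toDual_symm_apply (𝕜 := ℝ) (x := e φ) (y := L)
  rw [← hw] at h1
  rw [← inner_jumpMap hΩo hδ]
  refine Eq.trans h1 ?_
  simp [L]

/-- The operator of the energy inner product, from the energy space onto its dual. -/
theorem exists_energyEquiv (hd : 0 < d) (hΩo : IsOpen Ω) (hΩb : Bornology.IsBounded Ω)
    (hδ : 0 < δ) : ∃ A : energySpace γ δ Ω ≃ₗ[ℝ] energyDual γ δ Ω,
      ∀ w φ, (A w).1 φ = energyInner γ δ Ω w φ := by
  let B : energySpace γ δ Ω →ₗ[ℝ] energySpace γ δ Ω →ₗ[ℝ] ℝ :=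
    (innerₗ (Lp ℝ 2 (pairMeasure γ δ))).compl₁₂ (jumpMap hΩo hδ) (jumpMap hΩo hδ)
  have hB : ∀ w φ, B w φ = energyInner γ δ Ω w φ := fun w φ => inner_jumpMap hΩo hδ w φ
  let A₀ : energySpace γ δ Ω →ₗ[ℝ] energyDual γ δ Ω := B.codRestrict (energyDual γ δ Ω) fun w =>
    ⟨energyNorm γ δ Ω w, fun φ => by
      rw [hB, ← inner_jumpMap hΩo hδ, ← norm_jumpMap hΩo hδ, ← norm_jumpMap hΩo hδ]
      exact abs_real_inner_le_norm _ _⟩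
  refine ⟨LinearEquiv.ofBijective A₀ ⟨?_, fun ℓ => ?_⟩, hB⟩
  · rw [injective_iff_map_eq_zero]
    intro w hw
    have h1 : energyInner γ δ Ω w w = 0 := by
      rw [← hB]
      exact congrArg (fun ℓ : energyDual γ δ Ω => ℓ.1 w) hw
    rw [← inner_jumpMap hΩo hδ, inner_self_eq_zero] at h1
    exact jumpMap_injective hd hΩo hΩb hδ (h1.trans (map_zero _).symm)
  · obtain ⟨w, hw⟩ := exists_riesz hd hΩo hΩb hδ ℓ
    exact ⟨w, Subtype.ext (LinearMap.ext fun φ => (hB w φ).trans (hw φ))⟩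

end NonlocalConvection

namespace NonlocalConvection

variable {d : ℕ}

/-! ### Cutting off the diagonal, and the operator `-L_δ` -/

/-- The pairs of points at distance greater than `r`. -/
def cutSet (d : ℕ) (r : ℝ) : Set (Euc d × Euc d) := {p | r < ‖p.2 - p.1‖}

theorem measurableSet_cutSet (r : ℝ) : MeasurableSet (cutSet d r) :=
  measurableSet_lt measurable_const (measurable_snd.sub measurable_fst).norm

section Cut

variable {γ : DiffusionKernel d} {δ : ℝ} {Ω : Set (Euc d)}

/-- The diagonal is null for `pairMeasure`, so the cut-off indicators tend to `1` a.e. and dominated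
convergence applies. -/
theorem tendsto_setIntegral_cutSet (hδ : 0 < δ) {G : Euc d × Euc d → ℝ}
    (hG : Integrable G (pairMeasure γ δ)) :
    Tendsto (fun r => ∫ p in cutSet d r, G p ∂pairMeasure γ δ) (𝓝[>] 0)
      (𝓝 (∫ p, G p ∂pairMeasure γ δ)) := by
  simp_rw [← fun r => integral_indicator (f := G) (μ := pairMeasure γ δ)
    (measurableSet_cutSet (d := d) r)]
  refine tendsto_integral_filter_of_dominated_convergence (fun p => ‖G p‖)
    (Eventually.of_forall fun r => hG.1.indicator (measurableSet_cutSet r))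
    (Eventually.of_forall fun r => ae_of_all _ fun p => norm_indicator_le_norm_self _ _) hG.norm ?_
  filter_upwards [ae_pairMeasure_norm_mem γ hδ] with p hp
  refine tendsto_const_nhds.congr' ?_
  filter_upwards [mem_nhdsWithin_of_mem_nhds (Iio_mem_nhds hp.1)] with r hr
  exact (indicator_of_mem (show p ∈ cutSet d r from hr) _).symm

theorem setIntegral_cutSet_swap (r : ℝ) (G : Euc d × Euc d → ℝ) :
    ∫ p in cutSet d r, G p.swap ∂pairMeasure γ δ = ∫ p in cutSet d r, G p ∂pairMeasure γ δ := by
  have h := (measurePreserving_swap_pairMeasure γ δ).setIntegral_preimage_emb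
    MeasurableEquiv.prodComm.measurableEmbedding G (cutSet d r)
  have hpre : Prod.swap ⁻¹' cutSet d r = cutSet d r := by
    ext p
    simp only [cutSet, mem_preimage, mem_ofPred_eq, Prod.fst_swap, Prod.snd_swap, norm_sub_rev]
  rwa [hpre] at h

theorem integrableOn_cutSet_swap {r : ℝ} {G : Euc d × Euc d → ℝ}
    (hG : IntegrableOn G (cutSet d r) (pairMeasure γ δ)) :
    IntegrableOn (fun p => G p.swap) (cutSet d r) (pairMeasure γ δ) := by
  have h := ((measurePreserving_swap_pairMeasure γ δ).integrableOn_comp_preimage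
    MeasurableEquiv.prodComm.measurableEmbedding (f := G) (s := cutSet d r)).2 hG
  have hpre : Prod.swap ⁻¹' cutSet d r = cutSet d r := by
    ext p
    simp only [cutSet, mem_preimage, mem_ofPred_eq, Prod.fst_swap, Prod.snd_swap, norm_sub_rev]
  rwa [hpre] at h

/-- On the cut set `1 ≤ |y - x| / r`, so the weighted function dominates. This is what permits
splitting a jump into two separately integrable terms. -/
theorem memLp_fst_cutSet (hδ : 0 < δ) {r : ℝ} (hr : 0 < r) {f : Euc d → ℝ} (hf : Measurable f)
    (hf2 : MemLp f 2 volume) :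
    MemLp (fun p : Euc d × Euc d => f p.1) 2 ((pairMeasure γ δ).restrict (cutSet d r)) := by
  refine (((memLp_weight_mul_fst γ hδ hf hf2).restrict (cutSet d r)).const_mul r⁻¹).mono
    (hf.comp measurable_fst).aestronglyMeasurable ?_
  filter_upwards [ae_restrict_mem (measurableSet_cutSet r)] with p hp
  have hp' : r < ‖p.2 - p.1‖ := hp
  rw [norm_mul, norm_mul, norm_norm, ← mul_assoc, Real.norm_of_nonneg (inv_nonneg.2 hr.le)]
  refine le_mul_of_one_le_left (norm_nonneg _) ?_
  rw [inv_mul_eq_div, one_le_div hr]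
  exact hp'.le

theorem memLp_snd_cutSet (hδ : 0 < δ) {r : ℝ} (hr : 0 < r) {f : Euc d → ℝ} (hf : Measurable f)
    (hf2 : MemLp f 2 volume) :
    MemLp (fun p : Euc d × Euc d => f p.2) 2 ((pairMeasure γ δ).restrict (cutSet d r)) := by
  refine (memLp_two_iff_integrable_sq (hf.comp measurable_snd).aestronglyMeasurable).2 ?_
  exact integrableOn_cutSet_swap (memLp_fst_cutSet hδ hr hf hf2).integrable_sq

theorem setIntegral_pairMeasure_eq {s : Set (Euc d × Euc d)}
    (hs : MeasurableSet s) {G : Euc d × Euc d → ℝ} (hG : IntegrableOn G s (pairMeasure γ δ))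
    (hG0 : ∀ x ∉ Ω, ∀ y, G (x, y) = 0) :
    ∫ p in s, G p ∂pairMeasure γ δ
      = ∫ x in Ω, ∫ y in {y | (x, y) ∈ s}, γ.diff δ ‖y - x‖ * G (x, y) := by
  have h1 : Integrable (s.indicator G) (pairMeasure γ δ) := (integrable_indicator_iff hs).2 hG
  rw [← integral_indicator hs, integral_pairMeasure,
    integral_prod _ ((integrable_pairMeasure_iff γ δ _).1 h1),
    ← setIntegral_eq_integral_of_forall_compl_eq_zero (s := Ω)]
  · refine integral_congr_ae (ae_of_all _ fun x => ?_)
    have hsx : MeasurableSet {y | (x, y) ∈ s} := measurable_prodMk_left hs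
    simp only
    rw [← integral_indicator hsx]
    refine integral_congr_ae (ae_of_all _ fun y => ?_)
    by_cases hy : (x, y) ∈ s
    · simp only
      rw [indicator_of_mem hy, indicator_of_mem (show y ∈ {y | (x, y) ∈ s} from hy)]
    · simp only
      rw [indicator_of_notMem hy, indicator_of_notMem (show y ∉ {y | (x, y) ∈ s} from hy),
        mul_zero]
  · intro x hx
    simp only
    rw [← integral_zero (Euc d) ℝ]
    refine integral_congr_ae (ae_of_all _ fun y => ?_)
    by_cases hy : (x, y) ∈ s
    · simp only [indicator_of_mem hy, hG0 x hx y, mul_zero]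
    · simp only [indicator_of_notMem hy, mul_zero]

theorem ae_norm_lt_imp_of_ae_extended {P : Euc d → Prop} (hΩo : IsOpen Ω)
    (h : ∀ᵐ y ∂(volume.restrict (extendedDomain δ Ω)), P y) {x : Euc d} (hx : x ∈ Ω) :
    ∀ᵐ y, ‖y - x‖ < δ → P y := by
  rw [ae_restrict_iff' (measurableSet_extendedDomain δ hΩo)] at h
  filter_upwards [h] with y hy hyx
  exact hy (mem_extendedDomain_of_dist_lt hΩo hx hyx)

theorem ae_norm_sub_ne (hδ : 0 < δ) (x : Euc d) : ∀ᵐ y : Euc d, ‖y - x‖ ≠ δ := by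
  filter_upwards [measure_eq_zero_iff_ae_notMem.1
    (Measure.addHaar_sphere_of_ne_zero (volume : Measure (Euc d)) x hδ.ne')] with y hy
  simpa [dist_eq_norm] using hy

theorem ae_norm_lt_or_diff_eq_zero (γ : DiffusionKernel d) (hδ : 0 < δ) (x : Euc d) :
    ∀ᵐ y : Euc d, (0 < ‖y - x‖ ∧ ‖y - x‖ < δ) ∨ γ.diff δ ‖y - x‖ = 0 := by
  filter_upwards [ae_norm_sub_ne hδ x] with y hy
  by_cases h : ‖y - x‖ ∈ Ioc 0 δ
  · exact Or.inl ⟨h.1, lt_of_le_of_ne h.2 hy⟩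
  · exact Or.inr (γ.diff_of_not_mem h)

/-- `-L_δ w` is the functional `a(w, ·)`. -/
theorem isPrincipalValue_nlDiffusionCut (hΩo : IsOpen Ω) (hδ : 0 < δ) (w : energySpace γ δ Ω)
    (ℓ : energyDual γ δ Ω) (hℓ : ∀ φ, ℓ.1 φ = energyInner γ δ Ω w φ) :
    IsPrincipalValue γ δ Ω (fun r x => -nlDiffusionCut γ δ r w.1 x) ℓ := by
  intro φ
  have hw := memLp_jump_zeroExtension hΩo hδ w
  have hφ := memLp_jump_zeroExtension hΩo hδ φ
  rw [hℓ, energyInner_eq hΩo hδ]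
  refine (tendsto_setIntegral_cutSet hδ (hw.integrable_mul hφ)).congr' ?_
  filter_upwards [self_mem_nhdsWithin] with r hr
  have hr : 0 < r := hr
  have i₁ : IntegrableOn (fun p => jump (zeroExtension w) p * zeroExtension φ p.1) (cutSet d r)
      (pairMeasure γ δ) :=
    (hw.restrict _).integrable_mul (memLp_fst_cutSet hδ hr (measurable_zeroExtension hΩo φ)
      (memLp_zeroExtension hΩo φ))
  have i₂ : IntegrableOn (fun p => -(jump (zeroExtension w) p.swap * zeroExtension φ p.swap.1))
      (cutSet d r) (pairMeasure γ δ) := (integrableOn_cutSet_swap i₁).neg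
  -- Exchanging the variables turns the `φ(y)` term into a second copy of the `φ(x)` term; this is
  -- the factor `2` in `L_δ`.
  have h1 : ∫ p in cutSet d r, jump (zeroExtension w) p * jump (zeroExtension φ) p
      ∂pairMeasure γ δ = -2 * ∫ p in cutSet d r, jump (zeroExtension w) p * zeroExtension φ p.1
      ∂pairMeasure γ δ := by
    have h2 : ∀ p, jump (zeroExtension w) p * jump (zeroExtension φ) p
        = -(jump (zeroExtension w) p.swap * zeroExtension φ p.swap.1)
          - jump (zeroExtension w) p * zeroExtension φ p.1 := fun p => by
      simp only [jump, Prod.fst_swap, Prod.snd_swap]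
      ring
    simp_rw [h2]
    rw [integral_sub i₂ i₁, integral_neg, setIntegral_cutSet_swap r
      fun p => jump (zeroExtension w) p * zeroExtension φ p.1]
    ring
  refine h1.trans ?_
  rw [setIntegral_pairMeasure_eq (measurableSet_cutSet r) i₁
    (fun x hx y => by rw [zeroExtension_of_notMem φ hx, mul_zero]), ← integral_const_mul]
  refine setIntegral_congr_ae hΩo.measurableSet ?_
  filter_upwards [ae_restrict_self_of_ae_extended hΩo (ae_eq_zeroExtension hΩo w)] with x hwx hx
  have hset : MeasurableSet {y | y ∈ Metric.ball x δ ∧ r < ‖y - x‖} :=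
    Metric.isOpen_ball.measurableSet.inter
      (measurableSet_lt measurable_const (measurable_id.sub_const x).norm)
  have hset' : MeasurableSet {y : Euc d | (x, y) ∈ cutSet d r} :=
    measurable_prodMk_left (measurableSet_cutSet r)
  rw [nlDiffusionCut, ← zeroExtension_of_mem φ hx, ← neg_mul, mul_assoc, ← integral_mul_const]
  congr 1
  rw [← integral_indicator hset, ← integral_indicator hset']
  refine integral_congr_ae ?_
  -- The cut set is not confined to the ball of radius `δ`, but the kernel vanishes a.e. outside it.
  filter_upwards [ae_norm_lt_or_diff_eq_zero γ hδ x,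
    ae_norm_lt_imp_of_ae_extended hΩo (ae_eq_zeroExtension hΩo w) hx] with y hy hwy
  by_cases hc : r < ‖y - x‖
  · rw [indicator_of_mem (show y ∈ {y | (x, y) ∈ cutSet d r} from hc)]
    rcases hy with hy | hy
    · have hm : y ∈ {y | y ∈ Metric.ball x δ ∧ r < ‖y - x‖} :=
        ⟨by rw [Metric.mem_ball, dist_eq_norm]; exact hy.2, hc⟩
      rw [indicator_of_mem hm, hwy hy.2, hwx hx, jump]
      ring
    · rw [hy, zero_mul]
      by_cases hm : y ∈ {y | y ∈ Metric.ball x δ ∧ r < ‖y - x‖}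
      · rw [indicator_of_mem hm, hy, zero_mul, zero_mul]
      · rw [indicator_of_notMem hm]
  · rw [indicator_of_notMem (show y ∉ {y | (x, y) ∈ cutSet d r} from hc),
      indicator_of_notMem (fun h => hc h.2)]

end Cut

end NonlocalConvection

namespace NonlocalConvection

variable {d : ℕ}

/-! ### The convection weight and nonlocal integration by parts -/

open Classical in
/-- The factor of `γ_δ(|y - x|)` in the convection kernel: `1_{H x}(y) b(x) · (y - x) / η`. -/
noncomputable def influenceWeight (η : ℝ) (b : Euc d → Euc d) (H : Euc d → Set (Euc d))
    (p : Euc d × Euc d) : ℝ :=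
  if p.2 ∈ H p.1 then inner ℝ (b p.1) (p.2 - p.1) / η else 0

/-- Measurability and size conditions on the velocity and the influence regions. -/
structure IsAdmissible (η δ : ℝ) (b : Euc d → Euc d) (H : Euc d → Set (Euc d)) : Prop where
  measurableSet (x : Euc d) : MeasurableSet (H x)
  subset_ball (x : Euc d) : H x ⊆ Metric.ball x δ
  aestronglyMeasurable : AEStronglyMeasurable (influenceWeight η b H)
    ((volume : Measure (Euc d)).prod volume)
  bound : ∃ C : ℝ, 0 ≤ C ∧ ∀ᵐ p ∂(volume : Measure (Euc d)).prod volume,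
    |influenceWeight η b H p| ≤ C * ‖p.2 - p.1‖

theorem exists_influenceWeight_bound {η : ℝ} (hη : 0 < η) {b : Euc d → Euc d}
    (hb : MemLp b ⊤ volume) (H : Euc d → Set (Euc d)) :
    ∃ C : ℝ, 0 ≤ C ∧ ∀ᵐ p ∂(volume : Measure (Euc d)).prod volume,
      |influenceWeight η b H p| ≤ C * ‖p.2 - p.1‖ := by
  obtain ⟨B, hB⟩ : ∃ B : ℝ, ∀ᵐ x, ‖b x‖ ≤ B := by
    refine ⟨(eLpNorm b ⊤ volume).toReal, ?_⟩
    filter_upwards [ae_le_eLpNormEssSup (f := b) (μ := volume)] with x hx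
    rw [← eLpNorm_exponent_top] at hx
    simpa using ENNReal.toReal_mono hb.2.ne hx
  refine ⟨|B| / η, by positivity, ?_⟩
  filter_upwards [Measure.quasiMeasurePreserving_fst.ae hB] with p hp
  unfold influenceWeight
  split_ifs
  · rw [abs_div, abs_of_pos hη, div_mul_eq_mul_div]
    refine div_le_div_of_nonneg_right ((abs_real_inner_le_norm _ _).trans ?_) hη.le
    exact mul_le_mul_of_nonneg_right (hp.trans (le_abs_self B)) (norm_nonneg _)
  · rw [abs_zero]
    positivity

theorem aestronglyMeasurable_inner_sub {b : Euc d → Euc d} (hb : AEStronglyMeasurable b volume) :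
    AEStronglyMeasurable (fun p : Euc d × Euc d => inner ℝ (b p.1) (p.2 - p.1))
      ((volume : Measure (Euc d)).prod volume) :=
  (hb.comp_quasiMeasurePreserving Measure.quasiMeasurePreserving_fst).inner
    (measurable_snd.sub measurable_fst).aestronglyMeasurable

theorem ConstantFullBall.isAdmissible {η δ : ℝ} (hη : 0 < η) {b : Euc d → Euc d}
    {H : Euc d → Set (Euc d)} (hb : MemLp b ⊤ volume) (h : ConstantFullBall δ b H) :
    IsAdmissible η δ b H where
  measurableSet x := by rw [h.2 x]; exact Metric.isOpen_ball.measurableSet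
  subset_ball x := (h.2 x).le
  bound := exists_influenceWeight_bound hη hb H
  aestronglyMeasurable := by
    have hs : MeasurableSet {p : Euc d × Euc d | ‖p.2 - p.1‖ < δ} :=
      measurableSet_lt (measurable_snd.sub measurable_fst).norm measurable_const
    refine (((aestronglyMeasurable_inner_sub hb.1).mul_const η⁻¹).indicator hs).congr
      (ae_of_all _ fun p => ?_)
    simp [influenceWeight, indicator_apply, h.2, dist_eq_norm, div_eq_mul_inv]

theorem UpwindHemisphere.isAdmissible {γ : DiffusionKernel d} {η δ : ℝ} {Ω : Set (Euc d)}
    (hη : 0 < η) {b : Euc d → Euc d} {H : Euc d → Set (Euc d)} (hb : MemLp b ⊤ volume)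
    (h : UpwindHemisphere γ η δ Ω b H) : IsAdmissible η δ b H where
  measurableSet x := by
    rw [h.1 x]
    have hm : Measurable fun y : Euc d => -inner ℝ (b x) (y - x) :=
      (measurable_const.inner (measurable_id.sub_const x)).neg
    exact Metric.isOpen_ball.measurableSet.inter (measurableSet_lt measurable_const hm)
  subset_ball x := by
    rw [h.1 x]
    exact fun y hy => hy.1
  bound := exists_influenceWeight_bound hη hb H
  aestronglyMeasurable := by
    have hs : MeasurableSet {p : Euc d × Euc d | ‖p.2 - p.1‖ < δ} :=
      measurableSet_lt (measurable_snd.sub measurable_fst).norm measurable_const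
    -- Within distance `δ` the upwind condition and the weight combine into `min (b(x) · (y - x)) 0
    -- / η`, so joint measurability of the influence regions is not needed.
    refine ((((aestronglyMeasurable_inner_sub hb.1).inf
      (aestronglyMeasurable_const (b := (0 : ℝ)))).mul_const η⁻¹).indicator hs).congr
      (ae_of_all _ fun p => ?_)
    by_cases hp : ‖p.2 - p.1‖ < δ
    · rw [indicator_of_mem (show p ∈ {p : Euc d × Euc d | ‖p.2 - p.1‖ < δ} from hp)]
      by_cases hi : inner ℝ (b p.1) (p.2 - p.1) < 0
      · simp [influenceWeight, h.1, dist_eq_norm, hp, hi, hi.le, div_eq_mul_inv]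
      · simp [influenceWeight, h.1, dist_eq_norm, hp, hi, not_lt.1 hi]
    · rw [indicator_of_notMem (show p ∉ {p : Euc d × Euc d | ‖p.2 - p.1‖ < δ} from hp)]
      simp [influenceWeight, h.1, dist_eq_norm, hp]

theorem UpwindHemisphere.influenceWeight_nonpos {γ : DiffusionKernel d} {η δ : ℝ}
    {Ω : Set (Euc d)} (hη : 0 < η) {b : Euc d → Euc d} {H : Euc d → Set (Euc d)}
    (h : UpwindHemisphere γ η δ Ω b H) (p : Euc d × Euc d) : influenceWeight η b H p ≤ 0 := by
  unfold influenceWeight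
  split_ifs with hp
  · rw [h.1] at hp
    exact div_nonpos_of_nonpos_of_nonneg (by linarith [hp.2]) hη.le
  · exact le_rfl

variable {γ : DiffusionKernel d} {η δ : ℝ} {Ω : Set (Euc d)} {b : Euc d → Euc d}
  {H : Euc d → Set (Euc d)}

theorem IsAdmissible.memLp_mul_fst (hA : IsAdmissible η δ b H) (hδ : 0 < δ) {f : Euc d → ℝ}
    (hf : Measurable f) (hf2 : MemLp f 2 volume) :
    MemLp (fun p => influenceWeight η b H p * f p.1) 2 (pairMeasure γ δ) := by
  obtain ⟨C, hC0, hC⟩ := hA.bound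
  refine ((memLp_weight_mul_fst γ hδ hf hf2).const_mul C).mono
    ((hA.aestronglyMeasurable.mono_ac (pairMeasure_absolutelyContinuous γ δ)).mul
      (hf.comp measurable_fst).aestronglyMeasurable) ?_
  filter_upwards [(pairMeasure_absolutelyContinuous γ δ).ae_le hC] with p hp
  rw [norm_mul, norm_mul, norm_mul, norm_norm, ← mul_assoc, Real.norm_of_nonneg hC0]
  exact mul_le_mul_of_nonneg_right hp (norm_nonneg _)

theorem IsAdmissible.memLp_mul_snd (hA : IsAdmissible η δ b H) (hδ : 0 < δ) {f : Euc d → ℝ}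
    (hf : Measurable f) (hf2 : MemLp f 2 volume) :
    MemLp (fun p => influenceWeight η b H p * f p.2) 2 (pairMeasure γ δ) := by
  obtain ⟨C, hC0, hC⟩ := hA.bound
  have hw : MemLp (fun p : Euc d × Euc d => ‖p.2 - p.1‖ * f p.2) 2 (pairMeasure γ δ) := by
    refine ((memLp_weight_mul_fst γ hδ hf hf2).comp_measurePreserving
      (measurePreserving_swap_pairMeasure γ δ)).ae_eq (ae_of_all _ fun p => ?_)
    simp only [Function.comp_apply, Prod.fst_swap, Prod.snd_swap, norm_sub_rev]
  refine (hw.const_mul C).mono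
    ((hA.aestronglyMeasurable.mono_ac (pairMeasure_absolutelyContinuous γ δ)).mul
      (hf.comp measurable_snd).aestronglyMeasurable) ?_
  filter_upwards [(pairMeasure_absolutelyContinuous γ δ).ae_le hC] with p hp
  rw [norm_mul, norm_mul, norm_mul, norm_norm, ← mul_assoc, Real.norm_of_nonneg hC0]
  exact mul_le_mul_of_nonneg_right hp (norm_nonneg _)

theorem integrable_diff_mul_sq (γ : DiffusionKernel d) (hδ : 0 < δ) (x : Euc d) :
    Integrable (fun y => γ.diff δ ‖y - x‖ * ‖y - x‖ ^ 2) volume := by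
  have h : Integrable (fun z : Euc d => γ.diff δ ‖z‖ * ‖z‖ ^ 2) volume := by
    refine ⟨(((γ.measurable_diff δ).comp measurable_norm).mul
      (measurable_norm.pow_const 2)).aestronglyMeasurable, ?_⟩
    rw [hasFiniteIntegral_iff_ofReal (ae_of_all _ fun z =>
      mul_nonneg (γ.diff_nonneg _ _) (sq_nonneg _))]
    exact γ.lintegral_moment_lt_top hδ
  exact h.comp_sub_right x

/-- Since `γconv_δ = |y - x| γ_δ / η`, the integrand is dominated through `|y - x| |f(y) - f(x)| ≤
|y - x|² + (f(y) - f(x))²`. Integrability is what lets the inner product with `b(x)` pass under the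
integral. -/
theorem integrableOn_nlGradient_integrand (hA : IsAdmissible η δ b H) (hδ : 0 < δ)
    (hη : 0 < η) {x : Euc d} {u f : Euc d → ℝ} (hu : Measurable u)
    (huf : ∀ᵐ y, ‖y - x‖ < δ → u y = f y) (hux : u x = f x)
    (hf : Integrable (fun y => γ.diff δ ‖y - x‖ * jump f (x, y) ^ 2) volume) :
    IntegrableOn (fun y => (γ.conv η δ ‖y - x‖ * (u y - u x)) • ((1 / ‖y - x‖) • (y - x)))
      (H x) volume := by
  have hdom : Integrable (fun y => η⁻¹ * (γ.diff δ ‖y - x‖ * ‖y - x‖ ^ 2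
      + γ.diff δ ‖y - x‖ * jump f (x, y) ^ 2)) volume :=
    ((integrable_diff_mul_sq γ hδ x).add hf).const_mul η⁻¹
  refine Integrable.mono' hdom.integrableOn ?_ ?_
  · simp_rw [γ.conv_eq hδ]
    have hn : Measurable fun y : Euc d => ‖y - x‖ := (measurable_id.sub_const x).norm
    exact ((((hn.div_const η).mul ((γ.measurable_diff δ).comp hn)).mul (hu.sub_const _)).smul
      ((hn.const_div 1).smul (measurable_id.sub_const x))).aestronglyMeasurable
  · filter_upwards [ae_restrict_of_ae huf, ae_restrict_mem (hA.measurableSet x)] with y hy hyH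
    have hlt : ‖y - x‖ < δ := by
      have := hA.subset_ball x hyH
      rwa [Metric.mem_ball, dist_eq_norm] at this
    rw [norm_smul, norm_smul, norm_mul, γ.conv_eq hδ, hy hlt, hux]
    have h1 : ‖1 / ‖y - x‖‖ * ‖y - x‖ ≤ 1 := by
      rw [Real.norm_of_nonneg (by positivity), one_div]
      exact inv_mul_le_one
    have hg := γ.diff_nonneg δ ‖y - x‖
    rw [Real.norm_of_nonneg (mul_nonneg (by positivity) hg)]
    refine (mul_le_of_le_one_right (by positivity) h1).trans ?_
    have h2 : ‖y - x‖ * ‖f y - f x‖ ≤ ‖y - x‖ ^ 2 + jump f (x, y) ^ 2 := by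
      rw [jump, ← sq_abs (f y - f x), Real.norm_eq_abs]
      nlinarith [sq_nonneg (‖y - x‖ - |f y - f x|), sq_nonneg (‖y - x‖), sq_nonneg |f y - f x|]
    calc ‖y - x‖ / η * γ.diff δ ‖y - x‖ * ‖f y - f x‖
        = η⁻¹ * (γ.diff δ ‖y - x‖ * (‖y - x‖ * ‖f y - f x‖)) := by field_simp
      _ ≤ η⁻¹ * (γ.diff δ ‖y - x‖ * (‖y - x‖ ^ 2 + jump f (x, y) ^ 2)) := by gcongr
      _ = _ := by ring

/-- The factor `|y - x|` in the convection kernel cancels the normalisation of the direction vector.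
The double integral converges absolutely as a product of two `L²` functions, so Fubini applies. -/
theorem convectionForm_eq (hA : IsAdmissible η δ b H) (hΩo : IsOpen Ω) (hδ : 0 < δ) (hη : 0 < η)
    (u v : energySpace γ δ Ω) :
    convectionForm γ η δ Ω b H u v
      = ∫ p, (influenceWeight η b H p * zeroExtension v p.1) * jump (zeroExtension u) p
          ∂pairMeasure γ δ := by
  have hJ := memLp_jump_zeroExtension hΩo hδ u
  have hint := (hA.memLp_mul_fst (γ := γ) hδ (measurable_zeroExtension hΩo v)
    (memLp_zeroExtension hΩo v)).integrable_mul hJ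
  have h1 := setIntegral_pairMeasure_eq (Ω := Ω) MeasurableSet.univ hint.integrableOn
    (fun x hx y => by simp only [Pi.mul_apply, zeroExtension_of_notMem v hx, mul_zero, zero_mul])
  rw [setIntegral_univ] at h1
  refine Eq.trans ?_ h1.symm
  have hsq := (integrable_pairMeasure_iff γ δ _).1 hJ.integrable_sq
  refine setIntegral_congr_ae hΩo.measurableSet ?_
  filter_upwards [ae_restrict_self_of_ae_extended hΩo (ae_eq_zeroExtension hΩo u),
    hsq.prod_right_ae] with x hux hxi hx
  have huy := ae_norm_lt_imp_of_ae_extended hΩo (ae_eq_zeroExtension hΩo u) hx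
  have huniv : {y : Euc d | (x, y) ∈ (univ : Set (Euc d × Euc d))} = univ :=
    eq_univ_of_forall fun y => mem_univ (x, y)
  rw [huniv, setIntegral_univ, nlGradient, ← integral_inner (integrableOn_nlGradient_integrand hA hδ
    hη (Lp.stronglyMeasurable u.1).measurable huy (hux hx) hxi), ← zeroExtension_of_mem v hx,
    ← integral_mul_const, ← integral_indicator (hA.measurableSet x)]
  refine integral_congr_ae ?_
  filter_upwards [huy] with y hy
  by_cases hyH : y ∈ H x
  · have hlt : ‖y - x‖ < δ := by
      have := hA.subset_ball x hyH
      rwa [Metric.mem_ball, dist_eq_norm] at this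
    rw [indicator_of_mem hyH, Pi.mul_apply, influenceWeight, if_pos hyH, inner_smul_right,
      inner_smul_right, γ.conv_eq hδ, hy hlt, hux hx, jump]
    by_cases h0 : ‖y - x‖ = 0
    · rw [h0, γ.diff_of_not_mem (fun h => lt_irrefl _ h.1)]
      ring
    · field_simp
  · rw [indicator_of_notMem hyH, Pi.mul_apply, influenceWeight, if_neg hyH]
    ring

/-- Integration by parts: exchanging the variables in the `f(y)` half of the jump produces the `w(y)
1_{H y}(x)` term of the divergence, its sign coming from `x - y = -(y - x)`. It serves both for `g =
v` and, in the upwind case, for `g = 1`. -/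
theorem setIntegral_nlDivergenceCut (hΩo : IsOpen Ω) (hδ : 0 < δ)
    {r : ℝ} {g g' f : Euc d → ℝ}
    (hg : ∀ᵐ x ∂(volume.restrict (extendedDomain δ Ω)), g x = g' x) (hf : ∀ x ∉ Ω, f x = 0)
    (i₁ : IntegrableOn (fun p => influenceWeight η b H p * g' p.1 * f p.1) (cutSet d r)
      (pairMeasure γ δ))
    (i₂ : IntegrableOn (fun p => influenceWeight η b H p * g' p.1 * f p.2) (cutSet d r)
      (pairMeasure γ δ)) :
    ∫ x in Ω, nlDivergenceCut γ η δ H r (fun x => g x • b x) x * f x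
      = -∫ p in cutSet d r, influenceWeight η b H p * g' p.1 * jump f p ∂pairMeasure γ δ := by
  classical
  have i₃ := integrableOn_cutSet_swap i₂
  have h1 : -∫ p in cutSet d r, influenceWeight η b H p * g' p.1 * jump f p ∂pairMeasure γ δ
      = ∫ p in cutSet d r, (influenceWeight η b H p * g' p.1 * f p.1
        - influenceWeight η b H p.swap * g' p.swap.1 * f p.swap.2) ∂pairMeasure γ δ := by
    rw [integral_sub i₁ i₃, setIntegral_cutSet_swap r
      fun p => influenceWeight η b H p * g' p.1 * f p.2, ← integral_sub i₁ i₂, ← integral_neg]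
    refine integral_congr_ae (ae_of_all _ fun p => ?_)
    simp only [jump]
    ring
  have i₄ : IntegrableOn (fun p => influenceWeight η b H p * g' p.1 * f p.1
      - influenceWeight η b H p.swap * g' p.swap.1 * f p.swap.2) (cutSet d r)
      (pairMeasure γ δ) := i₁.sub i₃
  rw [h1, setIntegral_pairMeasure_eq (Ω := Ω) (measurableSet_cutSet r) i₄
    (fun x hx y => by simp [hf x hx])]
  refine setIntegral_congr_ae hΩo.measurableSet ?_
  filter_upwards [ae_restrict_self_of_ae_extended hΩo hg] with x hgx hx
  rw [nlDivergenceCut, ← integral_mul_const]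
  refine integral_congr_ae (ae_restrict_of_ae ?_)
  filter_upwards [ae_norm_lt_or_diff_eq_zero γ hδ x, ae_norm_lt_imp_of_ae_extended hΩo hg hx]
    with y hy hgy
  rw [γ.conv_eq hδ]
  rcases hy with hy | hy
  · have h0 : ‖y - x‖ ≠ 0 := hy.1.ne'
    simp only [influenceWeight, Prod.fst_swap, Prod.snd_swap]
    rw [hgx hx, hgy hy.2, inner_smul_right, inner_add_left]
    have e1 : inner ℝ (if y ∈ H x then g' x • b x else 0) (y - x)
        = g' x * if y ∈ H x then inner ℝ (b x) (y - x) else 0 := by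
      split_ifs <;> simp [inner_smul_left]
    have e2 : inner ℝ (if x ∈ H y then g' y • b y else 0) (y - x)
        = -(g' y * if x ∈ H y then inner ℝ (b y) (x - y) else 0) := by
      rw [← neg_sub x y, inner_neg_right]
      split_ifs <;> simp [inner_smul_left]
    have e3 : ∀ (P : Prop) [Decidable P] (a : ℝ), (if P then a / η else 0)
        = (if P then a else 0) / η := fun P _ a => by split_ifs <;> simp
    rw [e1, e2, e3, e3]
    field_simp
    ring
  · rw [hy]
    ring

end NonlocalConvection

namespace NonlocalConvection

variable {d : ℕ} {γ : DiffusionKernel d} {η δ : ℝ} {Ω : Set (Euc d)} {b : Euc d → Euc d}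
  {H : Euc d → Set (Euc d)}

/-! ### The functional `D_δ(b v)` and the skew case -/

theorem IsAdmissible.memLp_mul_zeroExtension (hA : IsAdmissible η δ b H) (hΩo : IsOpen Ω)
    (hδ : 0 < δ) (v : energySpace γ δ Ω) :
    MemLp (fun p => influenceWeight η b H p * zeroExtension v p.1) 2 (pairMeasure γ δ) :=
  hA.memLp_mul_fst hδ (measurable_zeroExtension hΩo v) (memLp_zeroExtension hΩo v)

/-- The convection weight times `v(x)`, as a linear map into `L²` of the pair measure. -/
noncomputable def convectionMap (hA : IsAdmissible η δ b H) (hΩo : IsOpen Ω) (hδ : 0 < δ) :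
    energySpace γ δ Ω →ₗ[ℝ] Lp ℝ 2 (pairMeasure γ δ) where
  toFun v := (hA.memLp_mul_zeroExtension hΩo hδ v).toLp _
  map_add' u v := by
    rw [← MemLp.toLp_add]
    refine MemLp.toLp_congr _ _ ?_
    filter_upwards [ae_fst_pairMeasure γ δ (zeroExtension_add hΩo u v)] with p hp
    rw [Pi.add_apply, hp]
    ring
  map_smul' c u := by
    rw [RingHom.id_apply, ← MemLp.toLp_const_smul]
    refine MemLp.toLp_congr _ _ ?_
    filter_upwards [ae_fst_pairMeasure γ δ (zeroExtension_smul hΩo c u)] with p hp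
    rw [Pi.smul_apply, hp, smul_eq_mul]
    ring

theorem inner_convectionMap (hA : IsAdmissible η δ b H) (hΩo : IsOpen Ω) (hδ : 0 < δ)
    (hη : 0 < η) (u v : energySpace γ δ Ω) :
    inner ℝ (convectionMap hA hΩo hδ v) (jumpMap hΩo hδ u)
      = convectionForm γ η δ Ω b H u v := by
  rw [convectionForm_eq hA hΩo hδ hη, L2.inner_def]
  refine integral_congr_ae ?_
  filter_upwards [coeFn_jumpMap hΩo hδ u, (hA.memLp_mul_zeroExtension hΩo hδ v).coeFn_toLp]
    with p hu hv
  rw [hu, show convectionMap hA hΩo hδ v p = _ from hv]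
  simp [mul_comm]

/-- `v ↦ D_δ(b v)`, as a linear map into the dual of the energy space. -/
theorem exists_divergenceMap (hA : IsAdmissible η δ b H) (hΩo : IsOpen Ω) (hδ : 0 < δ)
    (hη : 0 < η) : ∃ D : energySpace γ δ Ω →ₗ[ℝ] energyDual γ δ Ω,
      ∀ v φ, (D v).1 φ = -convectionForm γ η δ Ω b H φ v := by
  let B : energySpace γ δ Ω →ₗ[ℝ] energySpace γ δ Ω →ₗ[ℝ] ℝ :=
    -(innerₗ (Lp ℝ 2 (pairMeasure γ δ))).compl₁₂ (convectionMap hA hΩo hδ) (jumpMap hΩo hδ)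
  have hB : ∀ v φ, B v φ = -convectionForm γ η δ Ω b H φ v := fun v φ =>
    congrArg Neg.neg (inner_convectionMap hA hΩo hδ hη φ v)
  refine ⟨B.codRestrict (energyDual γ δ Ω) fun v => ⟨‖convectionMap hA hΩo hδ v‖, fun φ => ?_⟩, hB⟩
  rw [hB, abs_neg, ← inner_convectionMap hA hΩo hδ hη, ← norm_jumpMap hΩo hδ]
  exact abs_real_inner_le_norm _ _

/-- Integration by parts holds for each cut-off `r > 0`, and its right-hand side has a limit because
`κ(x,y) v(x)` times the jump of `φ` is integrable up to the diagonal. -/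
theorem isPrincipalValue_nlDivergenceCut (hA : IsAdmissible η δ b H) (hΩo : IsOpen Ω)
    (hδ : 0 < δ) (hη : 0 < η) (v : energySpace γ δ Ω) (ℓ : energyDual γ δ Ω)
    (hℓ : ∀ φ, ℓ.1 φ = -convectionForm γ η δ Ω b H φ v) :
    IsPrincipalValue γ δ Ω (fun r => nlDivergenceCut γ η δ H r (fun x => v.1 x • b x)) ℓ := by
  intro φ
  have hv := hA.memLp_mul_zeroExtension hΩo hδ v
  have hφ := memLp_jump_zeroExtension hΩo hδ φ
  rw [hℓ, convectionForm_eq hA hΩo hδ hη]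
  refine (tendsto_setIntegral_cutSet hδ (hv.integrable_mul hφ)).neg.congr' ?_
  filter_upwards [self_mem_nhdsWithin] with r hr
  have hm := measurable_zeroExtension hΩo φ
  have h2 := memLp_zeroExtension hΩo φ
  refine (setIntegral_nlDivergenceCut hΩo hδ (ae_eq_zeroExtension hΩo v)
    (fun x => zeroExtension_of_notMem φ)
    ((hv.restrict _).integrable_mul (memLp_fst_cutSet hδ hr hm h2))
    ((hv.restrict _).integrable_mul (memLp_snd_cutSet hδ hr hm h2))).symm.trans ?_
  refine setIntegral_congr_fun hΩo.measurableSet fun x hx => ?_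
  simp only [zeroExtension_of_mem φ hx]

theorem ConstantFullBall.influenceWeight_swap (h : ConstantFullBall δ b H)
    (p : Euc d × Euc d) : influenceWeight η b H p.swap = -influenceWeight η b H p := by
  obtain ⟨b₀, hb₀⟩ := h.1
  by_cases hp : ‖p.2 - p.1‖ < δ
  · simp only [influenceWeight, h.2, hb₀, Prod.fst_swap, Prod.snd_swap, Metric.mem_ball,
      dist_eq_norm, norm_sub_rev p.1 p.2, hp, if_true]
    rw [← neg_sub, inner_neg_right, neg_div]
  · simp [influenceWeight, h.2, dist_eq_norm, norm_sub_rev p.1 p.2, hp]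

theorem ConstantFullBall.influenceWeight_reflect (h : ConstantFullBall δ b H) (x y : Euc d) :
    influenceWeight η b H (x, x + x - y) = -influenceWeight η b H (x, y) := by
  have hxy : x + x - y - x = -(y - x) := by abel
  by_cases hp : ‖y - x‖ < δ
  · simp only [influenceWeight, h.2, Metric.mem_ball, dist_eq_norm, hxy, norm_neg, hp, if_true]
    rw [inner_neg_right, neg_div]
  · simp only [influenceWeight, h.2, Metric.mem_ball, dist_eq_norm, hxy, norm_neg, hp, if_false,
      neg_zero]

/-- For a constant velocity and full balls the convection form is skew. -/
theorem ConstantFullBall.convectionForm_self (h : ConstantFullBall δ b H)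
    (hA : IsAdmissible η δ b H) (hΩo : IsOpen Ω) (hδ : 0 < δ) (hη : 0 < η)
    (v : energySpace γ δ Ω) : convectionForm γ η δ Ω b H v v = 0 := by
  have hv := hA.memLp_mul_zeroExtension hΩo hδ v
  have hm := measurable_zeroExtension hΩo v
  have h2 := memLp_zeroExtension hΩo v
  rw [convectionForm_eq hA hΩo hδ hη]
  refine tendsto_nhds_unique (tendsto_setIntegral_cutSet hδ
    (hv.integrable_mul (memLp_jump_zeroExtension hΩo hδ v))) ?_
  refine tendsto_const_nhds.congr' ?_
  filter_upwards [self_mem_nhdsWithin] with r hr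
  have i₁ : IntegrableOn (fun p => influenceWeight η b H p * zeroExtension v p.1
      * zeroExtension v p.1) (cutSet d r) (pairMeasure γ δ) :=
    (hv.restrict _).integrable_mul (memLp_fst_cutSet hδ hr hm h2)
  have i₂ : IntegrableOn (fun p => influenceWeight η b H p * zeroExtension v p.1
      * zeroExtension v p.2) (cutSet d r) (pairMeasure γ δ) :=
    (hv.restrict _).integrable_mul (memLp_snd_cutSet hδ hr hm h2)
  -- For fixed `x` the integrand is odd under the reflection `y ↦ 2x - y`.
  have e₁ : ∫ p in cutSet d r, influenceWeight η b H p * zeroExtension v p.1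
      * zeroExtension v p.1 ∂pairMeasure γ δ = 0 := by
    rw [setIntegral_pairMeasure_eq (Ω := Ω) (measurableSet_cutSet r) i₁
      (fun x hx y => by simp [zeroExtension_of_notMem v hx])]
    refine integral_eq_zero_of_ae (ae_of_all _ fun x => ?_)
    have hs : MeasurableSet {y : Euc d | (x, y) ∈ cutSet d r} :=
      measurable_prodMk_left (measurableSet_cutSet r)
    simp only [Pi.zero_apply]
    rw [← integral_indicator hs]
    have hodd := integral_sub_left_eq_self ({y : Euc d | (x, y) ∈ cutSet d r}.indicator
      fun y => γ.diff δ ‖y - x‖ * (influenceWeight η b H (x, y) * zeroExtension v x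
        * zeroExtension v x)) volume (x + x)
    have hneg : ∀ y, {y : Euc d | (x, y) ∈ cutSet d r}.indicator
        (fun y => γ.diff δ ‖y - x‖ * (influenceWeight η b H (x, y) * zeroExtension v x
          * zeroExtension v x)) (x + x - y)
        = -{y : Euc d | (x, y) ∈ cutSet d r}.indicator
        (fun y => γ.diff δ ‖y - x‖ * (influenceWeight η b H (x, y) * zeroExtension v x
          * zeroExtension v x)) y := fun y => by
      have hn : ‖x + x - y - x‖ = ‖y - x‖ := by
        rw [← norm_neg]
        congr 1
        abel
      by_cases hy : r < ‖y - x‖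
      · rw [indicator_of_mem (show y ∈ {y : Euc d | (x, y) ∈ cutSet d r} from hy),
          indicator_of_mem (show x + x - y ∈ {y : Euc d | (x, y) ∈ cutSet d r} from
            hy.trans_eq hn.symm), hn, h.influenceWeight_reflect]
        ring
      · rw [indicator_of_notMem (show y ∉ {y : Euc d | (x, y) ∈ cutSet d r} from hy),
          indicator_of_notMem (show x + x - y ∉ {y : Euc d | (x, y) ∈ cutSet d r} from
            fun h' => hy (lt_of_lt_of_eq h' hn)), neg_zero]
    simp_rw [hneg] at hodd
    rw [integral_neg] at hodd
    linarith
  -- Here `v(x) v(y)` is symmetric and the weight antisymmetric under exchange of `x` and `y`.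
  have e₂ : ∫ p in cutSet d r, influenceWeight η b H p * zeroExtension v p.1
      * zeroExtension v p.2 ∂pairMeasure γ δ = 0 := by
    have hsw := setIntegral_cutSet_swap (γ := γ) (δ := δ) r fun p =>
      influenceWeight η b H p * zeroExtension v p.1 * zeroExtension v p.2
    have hneg : ∀ p : Euc d × Euc d, influenceWeight η b H p.swap * zeroExtension v p.swap.1
        * zeroExtension v p.swap.2
        = -(influenceWeight η b H p * zeroExtension v p.1 * zeroExtension v p.2) := fun p => by
      rw [h.influenceWeight_swap, Prod.fst_swap, Prod.snd_swap]
      ring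
    simp_rw [hneg] at hsw
    rw [integral_neg] at hsw
    linarith
  have e₃ := integral_sub i₂ i₁
  rw [e₁, e₂, sub_zero] at e₃
  rw [← e₃]
  refine integral_congr_ae (ae_of_all _ fun p => ?_)
  simp only [jump]
  ring

/-! ### Non-negativity of the convection form in the upwind case -/

/-- With `κ ≤ 0` one has `κ f(x)(f(y) - f(x)) ≥ ½ κ (f(y)² - f(x)²)`, and the right side integrates,
in the limit, to `-½ D_δ(b)` tested on `f² ≥ 0`. Boundedness of `f` is needed for `f²` to lie in the
energy space. -/
theorem UpwindHemisphere.integral_nonneg_of_bounded (h : UpwindHemisphere γ η δ Ω b H)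
    (hA : IsAdmissible η δ b H) (hΩo : IsOpen Ω) (hδ : 0 < δ) (hη : 0 < η) {f : Euc d → ℝ}
    (hf : Measurable f) (hf0 : ∀ x ∉ Ω, f x = 0) {M : ℝ} (hM : ∀ x, |f x| ≤ M)
    (hf2 : MemLp f 2 volume) (hJ : MemLp (jump f) 2 (pairMeasure γ δ)) :
    0 ≤ ∫ p, (influenceWeight η b H p * f p.1) * jump f p ∂pairMeasure γ δ := by
  obtain ⟨ℓ, hℓ, hpos⟩ := h.2
  have hM0 : 0 ≤ M := (abs_nonneg _).trans (hM 0)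
  have hq2 : MemLp (fun x => f x ^ 2) 2 volume := by
    refine (hf2.const_mul M).mono (hf.pow_const 2).aestronglyMeasurable (ae_of_all _ fun x => ?_)
    rw [norm_pow, norm_mul, Real.norm_eq_abs, Real.norm_of_nonneg hM0, sq]
    exact mul_le_mul_of_nonneg_right (hM x) (abs_nonneg _)
  -- The jump of `f²` is at most `2 M` times that of `f`.
  have hqJ : MemLp (jump fun x => f x ^ 2) 2 (pairMeasure γ δ) := by
    refine (hJ.const_mul (2 * M)).mono
      (measurable_jump (hf.pow_const 2)).aestronglyMeasurable (ae_of_all _ fun p => ?_)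
    rw [jump, jump, show f p.2 ^ 2 - f p.1 ^ 2 = (f p.2 + f p.1) * (f p.2 - f p.1) by ring,
      norm_mul, norm_mul, Real.norm_of_nonneg (by positivity : (0 : ℝ) ≤ 2 * M)]
    refine mul_le_mul_of_nonneg_right ((norm_add_le _ _).trans ?_) (norm_nonneg _)
    rw [Real.norm_eq_abs, Real.norm_eq_abs]
    linarith [hM p.1, hM p.2]
  obtain ⟨φ, hφ, -⟩ := exists_zeroExtension_eq hΩo hδ (hf.pow_const 2)
    (fun x hx => by simp [hf0 x hx]) hq2 hqJ
  have hφ0 : 0 ≤ -ℓ.1 φ := hpos φ (by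
    filter_upwards [hφ] with x hx
    rw [hx]
    positivity)
  have hκ := hA.memLp_mul_fst (γ := γ) hδ hf hf2
  have hκ' := hA.memLp_mul_snd (γ := γ) hδ hf hf2
  have hlim := tendsto_setIntegral_cutSet hδ (hκ.integrable_mul hJ)
  refine le_trans (by linarith) (le_of_tendsto_of_tendsto ((hℓ φ).neg.const_mul (1 / 2)) hlim ?_)
  filter_upwards [self_mem_nhdsWithin] with r hr
  have i₁ : IntegrableOn (fun p => influenceWeight η b H p * 1 * f p.1 ^ 2) (cutSet d r)
      (pairMeasure γ δ) :=
    ((hκ.restrict _).integrable_mul (memLp_fst_cutSet hδ hr hf hf2)).congr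
      (ae_of_all _ fun p => by simp only [Pi.mul_apply]; ring)
  have i₂ : IntegrableOn (fun p => influenceWeight η b H p * 1 * f p.2 ^ 2) (cutSet d r)
      (pairMeasure γ δ) :=
    ((hκ'.restrict _).integrable_mul (memLp_snd_cutSet hδ hr hf hf2)).congr
      (ae_of_all _ fun p => by simp only [Pi.mul_apply]; ring)
  have h1 := setIntegral_nlDivergenceCut (γ := γ) (η := η) (b := b) (H := H) (r := r)
    (g := fun _ => 1) (g' := fun _ => 1) (f := fun x => f x ^ 2) hΩo hδ
    (ae_of_all _ fun _ => rfl) (fun x hx => by simp [hf0 x hx]) i₁ i₂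
  simp only [one_smul] at h1
  have h2 : ∫ x in Ω, nlDivergenceCut γ η δ H r b x * φ.1 x
      = ∫ x in Ω, nlDivergenceCut γ η δ H r b x * f x ^ 2 := by
    refine setIntegral_congr_ae hΩo.measurableSet ?_
    filter_upwards [ae_restrict_self_of_ae_extended hΩo hφ] with x hx hxΩ
    rw [hx hxΩ]
  rw [h2, h1, neg_neg, ← integral_const_mul]
  refine integral_mono ?_ (hκ.integrable_mul hJ).integrableOn fun p => ?_
  · refine Integrable.const_mul ?_ _
    exact (i₂.sub i₁).congr (ae_of_all _ fun p => by simp only [Pi.sub_apply, jump]; ring)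
  · have h3 := h.influenceWeight_nonpos hη p
    simp only [jump, Pi.mul_apply]
    -- The difference of the two sides is `-½ κ (f(y) - f(x))²`.
    nlinarith [mul_nonneg (neg_nonneg.2 h3) (sq_nonneg (f p.2 - f p.1))]

/-- Truncation of a real number to `[-M, M]`. -/
def truncate (M t : ℝ) : ℝ := max (-M) (min M t)

theorem abs_truncate_sub_le (M s t : ℝ) : |truncate M s - truncate M t| ≤ |s - t| := by
  refine (abs_max_sub_max_le_max _ _ _ _).trans ?_
  rw [sub_self, abs_zero, max_eq_right (abs_nonneg _)]
  refine (abs_min_sub_min_le_max _ _ _ _).trans ?_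
  rw [sub_self, abs_zero, max_eq_right (abs_nonneg _)]

theorem truncate_zero {M : ℝ} (hM : 0 ≤ M) : truncate M 0 = 0 := by
  rw [truncate, min_eq_right hM, max_eq_right (neg_nonpos.2 hM)]

theorem abs_truncate_le_abs {M : ℝ} (hM : 0 ≤ M) (t : ℝ) : |truncate M t| ≤ |t| := by
  simpa [truncate_zero hM] using abs_truncate_sub_le M t 0

theorem abs_truncate_le {M : ℝ} (hM : 0 ≤ M) (t : ℝ) : |truncate M t| ≤ M :=
  abs_le.2 ⟨le_max_left _ _, max_le (by linarith) (min_le_left _ _)⟩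

theorem truncate_of_abs_le {M t : ℝ} (h : |t| ≤ M) : truncate M t = t := by
  rw [truncate, min_eq_right (abs_le.1 h).2, max_eq_right (abs_le.1 h).1]

theorem measurable_truncate (M : ℝ) : Measurable (truncate M) :=
  measurable_const.max (measurable_const.min measurable_id)

/-- Truncation is a contraction fixing `0`, so truncating `v` at height `n` increases neither its
values nor its jumps in absolute value; the bounded case passes to the limit by dominated
convergence. -/
theorem UpwindHemisphere.convectionForm_self_nonneg (h : UpwindHemisphere γ η δ Ω b H)
    (hA : IsAdmissible η δ b H) (hΩo : IsOpen Ω) (hδ : 0 < δ) (hη : 0 < η)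
    (v : energySpace γ δ Ω) : 0 ≤ convectionForm γ η δ Ω b H v v := by
  have hv := hA.memLp_mul_zeroExtension hΩo hδ v
  have hm := measurable_zeroExtension hΩo v
  have h2 := memLp_zeroExtension hΩo v
  have hJ := memLp_jump_zeroExtension hΩo hδ v
  rw [convectionForm_eq hA hΩo hδ hη]
  let f : ℕ → Euc d → ℝ := fun n x => truncate n (zeroExtension v x)
  have hfm : ∀ n, Measurable (f n) := fun n => (measurable_truncate n).comp hm
  have hlim : Tendsto (fun n => ∫ p, (influenceWeight η b H p * f n p.1) * jump (f n) p
      ∂pairMeasure γ δ) atTop (𝓝 (∫ p, (influenceWeight η b H p * zeroExtension v p.1)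
        * jump (zeroExtension v) p ∂pairMeasure γ δ)) := by
    refine tendsto_integral_of_dominated_convergence (fun p => ‖(influenceWeight η b H p
      * zeroExtension v p.1) * jump (zeroExtension v) p‖)
      (fun n => ?_) (hv.integrable_mul hJ).norm (fun n => ae_of_all _ fun p => ?_)
      (ae_of_all _ fun p => ?_)
    · exact ((hA.aestronglyMeasurable.mono_ac (pairMeasure_absolutelyContinuous γ δ)).mul
        ((hfm n).comp measurable_fst).aestronglyMeasurable).mul
        (measurable_jump (hfm n)).aestronglyMeasurable
    · simp only [norm_mul, Real.norm_eq_abs]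
      exact mul_le_mul (mul_le_mul_of_nonneg_left (abs_truncate_le_abs n.cast_nonneg _)
        (abs_nonneg _)) (abs_truncate_sub_le _ _ _) (abs_nonneg _) (by positivity)
    · obtain ⟨N, hN⟩ := exists_nat_ge (max |zeroExtension v p.1| |zeroExtension v p.2|)
      refine tendsto_const_nhds.congr' ?_
      filter_upwards [eventually_ge_atTop N] with n hn
      have hn' : (N : ℝ) ≤ n := by exact_mod_cast hn
      simp only [f, jump]
      rw [truncate_of_abs_le ((le_max_left _ _).trans (hN.trans hn')),
        truncate_of_abs_le ((le_max_right _ _).trans (hN.trans hn'))]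
  refine ge_of_tendsto' hlim fun n => h.integral_nonneg_of_bounded hA hΩo hδ hη (hfm n)
    (fun x hx => ?_) (fun x => abs_truncate_le n.cast_nonneg _) ?_ ?_
  · simp only [f, zeroExtension_of_notMem v hx, truncate_zero (n.cast_nonneg (α := ℝ))]
  · exact h2.mono (hfm n).aestronglyMeasurable
      (ae_of_all _ fun x => abs_truncate_le_abs n.cast_nonneg _)
  · exact hJ.mono (measurable_jump (hfm n)).aestronglyMeasurable
      (ae_of_all _ fun p => abs_truncate_sub_le _ _ _)

/-! ### The optimal norm -/

/-- Cauchy–Schwarz, attained at `u = z`; for `z = 0` the convention `0 / 0 = 0` gives the right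
value. -/
theorem isLUB_energyInner_div (hΩo : IsOpen Ω) (hδ : 0 < δ) (z : energySpace γ δ Ω) :
    IsLUB (range fun u : energySpace γ δ Ω => |energyInner γ δ Ω u z| / energyNorm γ δ Ω u)
      (energyNorm γ δ Ω z) := by
  refine IsGreatest.isLUB ⟨⟨z, ?_⟩, ?_⟩
  · simp only [← inner_jumpMap hΩo hδ, ← norm_jumpMap hΩo hδ, real_inner_self_eq_norm_sq]
    rw [abs_of_nonneg (sq_nonneg _), sq, mul_self_div_self]
  · rintro _ ⟨u, rfl⟩
    simp only [← inner_jumpMap hΩo hδ, ← norm_jumpMap hΩo hδ]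
    refine div_le_of_le_mul₀ (norm_nonneg _) (norm_nonneg _) ?_
    rw [mul_comm]
    exact abs_real_inner_le_norm _ _

end NonlocalConvection

open NonlocalConvection in
theorem mainTheorem2 {d : ℕ} (hd : 0 < d) (γ : DiffusionKernel d) (δ ε η : ℝ)
    (hδ : 0 < δ) (hε : 0 < ε) (hη : 0 < η)
    (Ω : Set (Euc d)) (hΩo : IsOpen Ω) (hΩb : Bornology.IsBounded Ω)
    (b : Euc d → Euc d) (hb : MemLp b ⊤ volume)
    (H : Euc d → Set (Euc d))
    (hH : ∀ x, b x ≠ 0 → volume (H x) = ENNReal.ofReal η * volume (Metric.ball x δ))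
    (hbH : ConstantFullBall δ b H ∨ UpwindHemisphere γ η δ Ω b H) :
    -- the optimal test norm is finite and is a norm on the energy space
    (∀ v : energySpace γ δ Ω, BddAbove (optQuotients γ η δ ε Ω b H v)) ∧
    (∃ N : Seminorm ℝ (energySpace γ δ Ω),
      (∀ v, N v = optNorm γ η δ ε Ω b H v) ∧ ∀ v, N v = 0 → v = 0) ∧
    -- `A` is the operator `-L_δ`, invertible onto the dual, and `D v` is `D_δ(b v)`
    ∃ (A : energySpace γ δ Ω ≃ₗ[ℝ] energyDual γ δ Ω)
      (D : energySpace γ δ Ω → energyDual γ δ Ω),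
      (∀ w, IsPrincipalValue γ δ Ω (fun r x => -nlDiffusionCut γ δ r w.1 x) (A w)) ∧
      (∀ v, IsPrincipalValue γ δ Ω
        (fun r => nlDivergenceCut γ η δ H r (fun x => v.1 x • b x)) (D v)) ∧
      (∀ v, optNorm γ η δ ε Ω b H v ^ 2 =
        ε ^ 2 * energyNorm γ δ Ω v ^ 2 + 2 * ε * convectionForm γ η δ Ω b H v v
          + (D v).1 (A.symm (D v))) ∧
      (ConstantFullBall δ b H →
        (∀ v, convectionForm γ η δ Ω b H v v = 0) ∧
        ∀ v, optNorm γ η δ ε Ω b H v ^ 2 =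
          ε ^ 2 * energyNorm γ δ Ω v ^ 2 + (D v).1 (A.symm (D v))) := by
  have hA : IsAdmissible η δ b H := hbH.elim (fun h => h.isAdmissible hη hb)
    fun h => h.isAdmissible hη hb
  have hpos : ∀ v : energySpace γ δ Ω, 0 ≤ convectionForm γ η δ Ω b H v v := fun v =>
    hbH.elim (fun h => (h.convectionForm_self hA hΩo hδ hη v).ge)
      fun h => h.convectionForm_self_nonneg hA hΩo hδ hη v
  obtain ⟨A, hAe⟩ := exists_energyEquiv (γ := γ) hd hΩo hΩb hδ
  obtain ⟨D, hD⟩ := exists_divergenceMap (γ := γ) hA hΩo hδ hη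
  -- `T v` is the Riesz representative of `b(·, v)` in the energy inner product.
  let T : energySpace γ δ Ω →ₗ[ℝ] energySpace γ δ Ω :=
    ε • LinearMap.id - A.symm.toLinearMap ∘ₗ D
  let J := jumpMap (γ := γ) hΩo hδ
  have hT : ∀ v, T v = ε • v - A.symm (D v) := fun v => rfl
  have hAD : ∀ v φ, energyInner γ δ Ω (A.symm (D v)) φ = -convectionForm γ η δ Ω b H φ v :=
    fun v φ => by rw [← hAe, LinearEquiv.apply_symm_apply, hD]
  have hsymm : ∀ u v : energySpace γ δ Ω, energyInner γ δ Ω u v = energyInner γ δ Ω v u :=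
    fun u v => by rw [← inner_jumpMap hΩo hδ, ← inner_jumpMap hΩo hδ, real_inner_comm]
  have hbil : ∀ u v, bilin γ η δ ε Ω b H u v = energyInner γ δ Ω u (T v) := fun u v => by
    have h1 := hAD v u
    rw [hsymm, ← inner_jumpMap hΩo hδ] at h1
    rw [bilin, hT, ← inner_jumpMap hΩo hδ, ← inner_jumpMap hΩo hδ, map_sub, map_smul,
      inner_sub_right, inner_smul_right, h1]
    ring
  have hlub : ∀ v, IsLUB (optQuotients γ η δ ε Ω b H v) (energyNorm γ δ Ω (T v)) := fun v => by
    simp only [optQuotients, hbil]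
    exact isLUB_energyInner_div hΩo hδ (T v)
  have hopt : ∀ v, optNorm γ η δ ε Ω b H v = energyNorm γ δ Ω (T v) := fun v =>
    (hlub v).csSup_eq (range_nonempty _)
  have hsq : ∀ v, optNorm γ η δ ε Ω b H v ^ 2 =
      ε ^ 2 * energyNorm γ δ Ω v ^ 2 + 2 * ε * convectionForm γ η δ Ω b H v v
        + (D v).1 (A.symm (D v)) := fun v => by
    have h1 := hAD v v
    have h2 : energyInner γ δ Ω (A.symm (D v)) (A.symm (D v)) = (D v).1 (A.symm (D v)) := by
      rw [← hAe, LinearEquiv.apply_symm_apply]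
    rw [hsymm, ← inner_jumpMap hΩo hδ] at h1
    rw [← inner_jumpMap hΩo hδ, real_inner_self_eq_norm_sq] at h2
    rw [hopt, hT, ← norm_jumpMap hΩo hδ, ← norm_jumpMap hΩo hδ, map_sub, map_smul,
      norm_sub_sq_real, inner_smul_left, h1, h2, norm_smul, mul_pow, Real.norm_eq_abs, sq_abs,
      conj_trivial]
    ring
  -- The optimal norm is the `L²` norm pulled back along the linear map `J ∘ T`, hence a seminorm.
  refine ⟨fun v => ⟨_, (hlub v).1⟩, ⟨(normSeminorm ℝ _).comp (J ∘ₗ T), fun v => ?_, fun v hv => ?_⟩,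
    A, D, fun w => isPrincipalValue_nlDiffusionCut hΩo hδ w _ (hAe w),
    fun v => isPrincipalValue_nlDivergenceCut hA hΩo hδ hη v _ (hD v), hsq, fun h =>
      ⟨h.convectionForm_self hA hΩo hδ hη, fun v => ?_⟩⟩
  · rw [hopt, ← norm_jumpMap hΩo hδ]
    rfl
  · have h1 : J (T v) = 0 := norm_eq_zero.1 hv
    -- Testing with `u = v` and using non-negativity of the convection form leaves `ε ‖J v‖² ≤ 0`.
    have h2 : bilin γ η δ ε Ω b H v v = 0 := by
      rw [hbil, ← inner_jumpMap hΩo hδ, show jumpMap hΩo hδ (T v) = 0 from h1, inner_zero_right]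
    have h3 : energyInner γ δ Ω v v = ‖J v‖ ^ 2 := by
      rw [← inner_jumpMap hΩo hδ, real_inner_self_eq_norm_sq]
    rw [bilin, h3] at h2
    have h4 : ‖J v‖ ^ 2 ≤ 0 := by
      have := hpos v
      by_contra! hc
      nlinarith [mul_pos hε hc]
    have h5 : ‖J v‖ = 0 := sq_nonpos_iff _ |>.1 h4
    have h6 : J v = 0 := norm_eq_zero.1 h5
    exact jumpMap_injective hd hΩo hΩb hδ (h6.trans J.map_zero.symm)
  · refine (hsq v).trans ?_
    rw [h.convectionForm_self hA hΩo hδ hη v]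
    ring
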